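/- **Setting.** Let $\mathfrak h$ be a $2M$-dimensional complex vector space with a nondegenerate symmetric bilinear form $(\cdot,\cdot)$ and a polarization $\mathfrak h=\mathfrak p\oplus\mathfrak q$ into isotropic subspaces of dimension $M$. Let $\hat{\mathfrak h}=\mathfrak h\otimes\mathbb C[t,t^{-1}]\oplus\mathbb C\mathbf k$ and let $N(\hat{\mathfrak h})$ be the quotient of the tensor algebra $T(\hat{\mathfrak h})$ by the two-sided ideal generated by $$(a\otimes t^m)(b\otimes t^n)+(b\otimes t^n)(a\otimes t^m)-(a,b)\,\delta_{m+n,0}\,\mathbf k,\qquad (a\otimes t^p)(b\otimes t^0)+(b\otimes t^0)(a\otimes t^p),\qquad (a\otimes t^q)\mathbf k-\mathbf k(a\otimes t^q)$$ for $a,b\in\mathfrak h$, $m>0>n$, $p\neq 0$, $q\in\mathbb Z$. (No relations are imposed among positive modes, among negative modes, or among zero modes.) Let $U$ be a $T(\mathfrak h)$-module; let $a\otimes t^m$ ($m>0$) act on $U$ by $0$, $a\otimes t^0$ as $a$, and $\mathbf k$ by $1$. Let $W$ be the $N(\hat{\mathfrak h})$-module induced from $U$, regarded as a module for the subalgebra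 generated by $\mathbf k$ and all $a\otimes t^m$ with $m\ge 0$. Write $h(n)$ for the action of $h\otimes t^n$ on $W$. **Normal ordering.** For zero modes, the normal-ordered product $:a_1(0)\cdots a_r(0):$ is defined recursively by setting the empty product equal to $1$ and $$:a_1(0)\cdots a_r(0):\;=\;a_1(0):a_2(0)\cdots a_r(0):+\sum_{i=2}^r\frac{(-1)^{i+1}}2(a_1,a_i):a_2(0)\cdots\widehat{a_i(0)}\cdots a_r(0):.$$ For $h_1,\dots,h_r\in\mathfrak h$ and $k_1,\dots,k_r\in\mathbb Z$, $$:h_1(k_1)\cdots h_r(k_r):\;=(-1)^\sigma h_{\sigma(1)}(k_{\sigma(1)})\cdots h_{\sigma(\nu)}(k_{\sigma(\nu)}):h_{\sigma(\nu+1)}(0)\cdots h_{\sigma(r)}(0):,$$ where $\sigma$ is the permutation of $\{1,\dots,r\}$ that lists first the indices of the negative modes, then those of the positive modes, then those of the zero modes, each group in increasing order, and $\nu$ is the number of nonzero modes. With $(x^{p})^{(m)}=\binom{p}{m}x^{p-m}$ and $h^{(m)}(x)=\sum_{n\in\mathbb Z}h(n)\,(x^{-n-1/2})^{(m)}$, the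 normal-ordered product of such series in distinct variables is defined by components: $$:h_1^{(m_1)}(x_1)\cdots h_r^{(m_r)}(x_r):\;=\sum_{k_1,\dots,k_r\in\mathbb Z}:h_1(k_1)\cdots h_r(k_r):\,(x_1^{-k_1-1/2})^{(m_1)}\cdots(x_r^{-k_r-1/2})^{(m_r)}.$$ **Contractions.** Let $$g(x,y)=\tfrac12\,x^{-1/2}y^{-1/2}(x+y)(x-y)^{-1},\qquad g_{mn}=\frac1{m!\,n!}\frac{\partial^{m+n}g}{\partial x^m\partial y^n},\qquad G_{mn}(x,y)=\iota_{xy}\,g_{mn}(x,y),$$ where $\iota_{xy}$ expands $(x-y)^t$ as $\sum_{k\ge0}\binom tk x^{t-k}(-y)^k$. **Theorem (Wick's theorem).** For all $r,s\ge1$, $a_1,\dots,a_r,b_1,\dots,b_s\in\mathfrak h$ and $m_1,\dots,m_r,n_1,\dots,n_s\in\mathbb N=\{0,1,2,\dots\}$, all products of formal series below exist (every coefficient is a finite sum), and, as formal series in $x_1,\dots,x_r,y_1,\dots,y_s$ with coefficients in $\operatorname{End}(W)$, $$\begin{aligned} &:a_1^{(m_1)}(x_1)\cdots a_r^{(m_r)}(x_r):\cdot:b_1^{(n_1)}(y_1)\cdots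 b_s^{(n_s)}(y_s):\\ &=\;:a_1^{(m_1)}(x_1)\cdots a_r^{(m_r)}(x_r)\,b_1^{(n_1)}(y_1)\cdots b_s^{(n_s)}(y_s):\\ &\quad+\sum_{\rho=1}^{\min(r,s)}\ \sum_{\substack{1\le i_1<\cdots<i_\rho\le r\\1\le j_1<\cdots<j_\rho\le s}}(-1)^{i_1+\cdots+i_\rho+j_1+\cdots+j_\rho}(-1)^{r\rho+\rho(\rho+1)/2}\, \det\Big[(a_{i_k},b_{j_l})\,G_{m_{i_k}n_{j_l}}(x_{i_k},y_{j_l})\Big]_{k,l=1}^{\rho}\\ &\qquad\qquad\cdot\;:\prod_{i\notin\{i_1,\dots,i_\rho\}}a_i^{(m_i)}(x_i)\prod_{j\notin\{j_1,\dots,j_\rho\}}b_j^{(n_j)}(y_j):, \end{aligned}$$ where the remaining factors stand in increasing order of their indices. -/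

import Mathlib

open scoped TensorProduct

noncomputable section

namespace TwistedFock

/-! ### The algebra of modes and the induced module -/

/-- The affinization `ĥ = 𝔥 ⊗ ℂ[t, t⁻¹] ⊕ ℂ 𝐤`. -/
abbrev Affinization (H : Type*) [AddCommGroup H] [Module ℂ H] : Type _ :=
  (H ⊗[ℂ] LaurentPolynomial ℂ) × ℂ

/-- `a ⊗ t ^ m`, as an element of degree one of the tensor algebra of `ĥ`. -/
def gen {H : Type*} [AddCommGroup H] [Module ℂ H] (a : H) (m : ℤ) :
    TensorAlgebra ℂ (Affinization H) :=
  TensorAlgebra.ι ℂ ((a ⊗ₜ[ℂ] (LaurentPolynomial.T m : LaurentPolynomial ℂ), (0 : ℂ)) :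
    Affinization H)

/-- `𝐤`, as an element of degree one of the tensor algebra of `ĥ`. -/
def central (H : Type*) [AddCommGroup H] [Module ℂ H] : TensorAlgebra ℂ (Affinization H) :=
  TensorAlgebra.ι ℂ (((0 : H ⊗[ℂ] LaurentPolynomial ℂ), (1 : ℂ)) : Affinization H)

/-- The defining relations: a positive and a negative mode anticommute up to a central term, a
nonzero mode and a zero mode anticommute, and `𝐤` commutes with all modes. There is no relation
between two positive modes, two negative modes or two zero modes. -/
inductive Rel {H : Type*} [AddCommGroup H] [Module ℂ H] (B : LinearMap.BilinForm ℂ H) :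
    TensorAlgebra ℂ (Affinization H) → TensorAlgebra ℂ (Affinization H) → Prop
  | pos_neg (a b : H) (m n : ℤ) (hm : 0 < m) (hn : n < 0) :
      Rel B (gen a m * gen b n + gen b n * gen a m)
        (if m + n = 0 then B a b • central H else 0)
  | nonzero_zero (a b : H) (p : ℤ) (hp : p ≠ 0) :
      Rel B (gen a p * gen b 0 + gen b 0 * gen a p) 0
  | comm_central (a : H) (q : ℤ) :
      Rel B (gen a q * central H) (central H * gen a q)

/-- The algebra `N(ĥ)`: the tensor algebra of `ĥ` modulo the two-sided ideal generated by the
relations. -/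
def NAlg {H : Type*} [AddCommGroup H] [Module ℂ H] (B : LinearMap.BilinForm ℂ H) : Type _ :=
  RingQuot (Rel B)

instance {H : Type*} [AddCommGroup H] [Module ℂ H] (B : LinearMap.BilinForm ℂ H) :
    Ring (NAlg B) :=
  inferInstanceAs (Ring (RingQuot (Rel B)))

instance {H : Type*} [AddCommGroup H] [Module ℂ H] (B : LinearMap.BilinForm ℂ H) :
    Algebra ℂ (NAlg B) :=
  inferInstanceAs (Algebra ℂ (RingQuot (Rel B)))

/-- The projection of the tensor algebra onto `N(ĥ)`. -/
def toN {H : Type*} [AddCommGroup H] [Module ℂ H] (B : LinearMap.BilinForm ℂ H) :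
    TensorAlgebra ℂ (Affinization H) →ₐ[ℂ] NAlg B :=
  RingQuot.mkAlgHom ℂ (Rel B)

/-- The relations `n b ⊗ u = n ⊗ b u` that turn `N(ĥ) ⊗ U` into the induced module, for `b` in the
generators of the subalgebra generated by the nonnegative modes and `𝐤`: the positive modes act on
`U` as `0`, the zero mode of `a` acts as `a ∈ T(𝔥)`, and `𝐤` acts as `1`. The `N(ĥ)`-submodule
spanned by the relations with `n = 1` contains those for all `n`. -/
def inducedRel {H : Type*} [AddCommGroup H] [Module ℂ H] (B : LinearMap.BilinForm ℂ H)
    (U : Type*) [AddCommGroup U] [Module ℂ U] [Module (TensorAlgebra ℂ H) U] :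
    Submodule (NAlg B) (NAlg B ⊗[ℂ] U) :=
  Submodule.span (NAlg B)
    ({z | ∃ (a : H) (m : ℤ) (u : U), 0 < m ∧ z = toN B (gen a m) ⊗ₜ[ℂ] u} ∪
     {z | ∃ (a : H) (u : U),
        z = toN B (gen a 0) ⊗ₜ[ℂ] u - (1 : NAlg B) ⊗ₜ[ℂ] (TensorAlgebra.ι ℂ a • u)} ∪
     {z | ∃ u : U, z = toN B (central H) ⊗ₜ[ℂ] u - (1 : NAlg B) ⊗ₜ[ℂ] u})

/-- The induced module `W` of the `T(𝔥)`-module `U`. -/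
def Fock {H : Type*} [AddCommGroup H] [Module ℂ H] (B : LinearMap.BilinForm ℂ H)
    (U : Type*) [AddCommGroup U] [Module ℂ U] [Module (TensorAlgebra ℂ H) U] : Type _ :=
  (NAlg B ⊗[ℂ] U) ⧸ inducedRel B U

instance {H : Type*} [AddCommGroup H] [Module ℂ H] (B : LinearMap.BilinForm ℂ H)
    (U : Type*) [AddCommGroup U] [Module ℂ U] [Module (TensorAlgebra ℂ H) U] : AddCommGroup (Fock B U) :=
  inferInstanceAs (AddCommGroup ((NAlg B ⊗[ℂ] U) ⧸ inducedRel B U))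

instance {H : Type*} [AddCommGroup H] [Module ℂ H] (B : LinearMap.BilinForm ℂ H)
    (U : Type*) [AddCommGroup U] [Module ℂ U] [Module (TensorAlgebra ℂ H) U] : Module (NAlg B) (Fock B U) :=
  inferInstanceAs (Module (NAlg B) ((NAlg B ⊗[ℂ] U) ⧸ inducedRel B U))

instance {H : Type*} [AddCommGroup H] [Module ℂ H] (B : LinearMap.BilinForm ℂ H)
    (U : Type*) [AddCommGroup U] [Module ℂ U] [Module (TensorAlgebra ℂ H) U] : Module ℂ (Fock B U) :=
  inferInstanceAs (Module ℂ ((NAlg B ⊗[ℂ] U) ⧸ inducedRel B U))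

instance {H : Type*} [AddCommGroup H] [Module ℂ H] (B : LinearMap.BilinForm ℂ H)
    (U : Type*) [AddCommGroup U] [Module ℂ U] [Module (TensorAlgebra ℂ H) U] : IsScalarTower ℂ (NAlg B) (Fock B U) :=
  inferInstanceAs (IsScalarTower ℂ (NAlg B) ((NAlg B ⊗[ℂ] U) ⧸ inducedRel B U))

/-- The mode `h(n)`: the action of `h ⊗ t ^ n` on `W`. -/
def mode {H : Type*} [AddCommGroup H] [Module ℂ H] (B : LinearMap.BilinForm ℂ H)
    (U : Type*) [AddCommGroup U] [Module ℂ U] [Module (TensorAlgebra ℂ H) U]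
    (h : H) (n : ℤ) : Module.End ℂ (Fock B U) :=
  Algebra.lsmul ℂ ℂ (Fock B U) (toN B (gen h n))

/-! ### Normal ordering of modes -/

/-- The normal ordering of a product of zero modes, by its recursion from the left. In the sum, the
(0-based) `k`-th entry of the tail is the factor number `i = k + 2` of the product, so that
`(-1) ^ (i + 1) = (-1) ^ (k + 1)`. -/
def zeroNord {H : Type*} [AddCommGroup H] [Module ℂ H] (B : LinearMap.BilinForm ℂ H)
    (U : Type*) [AddCommGroup U] [Module ℂ U] [Module (TensorAlgebra ℂ H) U] :
    List H → Module.End ℂ (Fock B U)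
  | [] => 1
  | a :: l =>
      mode B U a 0 * zeroNord B U l +
        ∑ k : Fin l.length,
          ((-1 : ℂ) ^ ((k : ℕ) + 1) / 2 * B a (l.get k)) • zeroNord B U (l.eraseIdx k)
  termination_by l => l.length
  decreasing_by
    · simp
    · have := k.isLt
      simp only [List.length_eraseIdx, List.length_cons]
      split <;> omega

/-- The position of a mode in a normal-ordered product: negative, then positive, then zero. -/
def modeClass (n : ℤ) : ℕ := if n < 0 then 0 else if 0 < n then 1 else 2

/-- The 3-shuffle of a product of modes: `Tuple.sort` is the stable sorting permutation, which
lists the indices of the negative modes, of the positive modes and of the zero modes, each in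
increasing order. -/
def shuffle {H : Type*} (l : List (H × ℤ)) : Equiv.Perm (Fin l.length) :=
  Tuple.sort fun i => modeClass (l.get i).2

/-- The normal ordering of the product of modes `h₁(m₁) ⋯ h_r(m_r)`, given as the list of the pairs
`(h_i, m_i)`. -/
def nord {H : Type*} [AddCommGroup H] [Module ℂ H] (B : LinearMap.BilinForm ℂ H)
    (U : Type*) [AddCommGroup U] [Module ℂ U] [Module (TensorAlgebra ℂ H) U]
    (l : List (H × ℤ)) : Module.End ℂ (Fock B U) :=
  ((Equiv.Perm.sign (shuffle l) : ℤ) : ℂ) •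
    (((l.filter fun x => x.2 < 0).map fun x => mode B U x.1 x.2).prod *
      ((l.filter fun x => 0 < x.2).map fun x => mode B U x.1 x.2).prod *
      zeroNord B U ((l.filter fun x => x.2 = 0).map Prod.fst))

/-! ### Formal series -/

/-- Exponents of monomials in the variables `x₁, …, x_r, y₁, …, y_s`. A formal series with
coefficients in `E` is a function `Expo r s → E`. The order, which is reversed in the exponents of
the `x_i`, only serves to make the Hahn series below those that are expanded in negative powers of
the `x_i` and positive powers of the `y_j`. -/
abbrev Expo (r s : ℕ) : Type := (Fin r → ℚᵒᵈ) × (Fin s → ℚ)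

/-- The exponent of the monomial `v ^ p`, where `v` is the variable `x_i` (`Sum.inl i`) or `y_j`
(`Sum.inr j`). -/
def expo {r s : ℕ} (v : Fin r ⊕ Fin s) (p : ℚ) : Expo r s :=
  match v with
  | Sum.inl i => (Pi.single i (OrderDual.toDual p), 0)
  | Sum.inr j => (0, Pi.single j p)

/-- The coefficientwise product of formal series. -/
def conv {r s : ℕ} {A E : Type*} [SMul A E] [AddCommMonoid E]
    (c : Expo r s → A) (F : Expo r s → E) : Expo r s → E :=
  fun e => ∑ᶠ p, c p • F (e - p)

/-- The product of two formal series exists: each of its coefficients is a finite sum. -/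
def ConvExists {r s : ℕ} {A E : Type*} [Zero A] [Zero E]
    (c : Expo r s → A) (F : Expo r s → E) : Prop :=
  ∀ e, {p | c p ≠ 0 ∧ F (e - p) ≠ 0}.Finite

/-! ### Normal ordering of generating series -/

/-- A factor `h^{(m)}(v)`, with `v` one of the variables `x₁, …, x_r, y₁, …, y_s`. -/
structure Factor (H : Type*) (r s : ℕ) where
  vec : H
  order : ℕ
  var : Fin r ⊕ Fin s

/-- The exponent of the monomial
`(v₁ ^ (-n₁ - 1/2))^{(m₁)} ⋯ (v_k ^ (-n_k - 1/2))^{(m_k)}`. -/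
def Factor.totalExpo {H : Type*} {r s : ℕ} (l : List (Factor H r s)) (n : Fin l.length → ℤ) :
    Expo r s :=
  ∑ i, expo (l.get i).var (-(n i : ℚ) - 1 / 2 - ((l.get i).order : ℚ))

/-- The coefficient of the monomial
`(v₁ ^ (-n₁ - 1/2))^{(m₁)} ⋯ (v_k ^ (-n_k - 1/2))^{(m_k)}`. -/
def Factor.totalCoeff {H : Type*} {r s : ℕ} (l : List (Factor H r s)) (n : Fin l.length → ℤ) :
    ℂ :=
  ∏ i, ((Ring.choose (-(n i : ℚ) - 1 / 2) (l.get i).order : ℚ) : ℂ)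

open Classical in
/-- The normal-ordered product of the generating series in a list of factors with pairwise distinct
variables, defined by components: the sum over all `n₁, …, n_k ∈ ℤ` of
`nord(h₁(n₁) ⋯ h_k(n_k)) (v₁ ^ (-n₁ - 1/2))^{(m₁)} ⋯ (v_k ^ (-n_k - 1/2))^{(m_k)}`.
As the variables are distinct, at most one tuple contributes to each coefficient. -/
def nordSeries {H : Type*} [AddCommGroup H] [Module ℂ H] (B : LinearMap.BilinForm ℂ H)
    (U : Type*) [AddCommGroup U] [Module ℂ U] [Module (TensorAlgebra ℂ H) U] {r s : ℕ}
    (l : List (Factor H r s)) : Expo r s → Module.End ℂ (Fock B U) :=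
  fun e => ∑ᶠ n : Fin l.length → ℤ,
    if Factor.totalExpo l n = e then
      Factor.totalCoeff l n • nord B U (List.ofFn fun i => ((l.get i).vec, n i))
    else 0

/-- The factors `a_i^{(m_i)}(x_i)`, in increasing order of `i`, with those for `i ∈ I` omitted. -/
def xFactors {H : Type*} {r : ℕ} (s : ℕ) (a : Fin r → H) (m : Fin r → ℕ) (I : Finset (Fin r)) :
    List (Factor H r s) :=
  ((List.finRange r).filter fun i => i ∉ I).map fun i => ⟨a i, m i, Sum.inl i⟩

/-- The factors `b_j^{(n_j)}(y_j)`, in increasing order of `j`, with those for `j ∈ J` omitted. -/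
def yFactors {H : Type*} (r : ℕ) {s : ℕ} (b : Fin s → H) (n : Fin s → ℕ) (J : Finset (Fin s)) :
    List (Factor H r s) :=
  ((List.finRange s).filter fun j => j ∉ J).map fun j => ⟨b j, n j, Sum.inr j⟩

/-! ### The functions `g_{mn}` and their expansions -/

/-- Finite linear combinations of terms `x ^ p * y ^ q * (x - y) ^ t`, with `p, q ∈ ℚ`, `t ∈ ℤ`;
such a term is the basis vector `(p, q, t)`. -/
abbrev AlgFun : Type := (ℚ × ℚ × ℤ) →₀ ℂ

/-- The partial derivative with respect to `x`. -/
def derivX : AlgFun →ₗ[ℂ] AlgFun :=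
  Finsupp.linearCombination ℂ fun w : ℚ × ℚ × ℤ =>
    Finsupp.single (w.1 - 1, w.2.1, w.2.2) (w.1 : ℂ) +
      Finsupp.single (w.1, w.2.1, w.2.2 - 1) (w.2.2 : ℂ)

/-- The partial derivative with respect to `y`. -/
def derivY : AlgFun →ₗ[ℂ] AlgFun :=
  Finsupp.linearCombination ℂ fun w : ℚ × ℚ × ℤ =>
    Finsupp.single (w.1, w.2.1 - 1, w.2.2) (w.2.1 : ℂ) -
      Finsupp.single (w.1, w.2.1, w.2.2 - 1) (w.2.2 : ℂ)

/-- `g(x, y) = x ^ (-1/2) * y ^ (-1/2) * (1/2) * (x + y) * (x - y)⁻¹`, multiplied out. -/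
def g : AlgFun :=
  Finsupp.single (1 / 2, -1 / 2, -1) (1 / 2) + Finsupp.single (-1 / 2, 1 / 2, -1) (1 / 2)

/-- `g_{mn} = (1 / (m! n!)) ∂^{m+n} g / ∂x^m ∂y^n`. -/
def gDeriv (m n : ℕ) : AlgFun :=
  (1 / ((m.factorial : ℂ) * (n.factorial : ℂ))) • (derivX ^ m) ((derivY ^ n) g)

/-- `k ↦` the exponent of `x_i ^ (p - k) * y_j ^ (q + k)`. -/
def expansionExpo {r s : ℕ} (i : Fin r) (j : Fin s) (p q : ℚ) : ℕ ↪o Expo r s :=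
  OrderEmbedding.ofMapLEIff
    (fun k => (Pi.single i (OrderDual.toDual (p - (k : ℚ))), Pi.single j (q + (k : ℚ)))) <| by
      intro k l
      rw [Prod.mk_le_mk, Pi.single_le_single, Pi.single_le_single, OrderDual.toDual_le_toDual]
      constructor
      · rintro ⟨-, h⟩
        exact_mod_cast (add_le_add_iff_left q).1 h
      · intro h
        have h' : (k : ℚ) ≤ l := by exact_mod_cast h
        exact ⟨by linarith, by linarith⟩

/-- The expansion `ι_{x_i y_j}`, which expands powers of `x_i - y_j` in nonnegative powers of `y_j`:
`x ^ p * y ^ q * (x - y) ^ t ↦ ∑_{k ≥ 0} binom(t, k) * (-1) ^ k * x ^ (p + t - k) * y ^ (q + k)`. -/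
def iota {r s : ℕ} (i : Fin r) (j : Fin s) : AlgFun →ₗ[ℂ] HahnSeries (Expo r s) ℂ :=
  Finsupp.linearCombination ℂ fun w : ℚ × ℚ × ℤ =>
    HahnSeries.embDomain (expansionExpo i j (w.1 + (w.2.2 : ℚ)) w.2.1)
      (HahnSeries.toPowerSeries.symm
        (PowerSeries.mk fun k => ((Ring.choose w.2.2 k : ℤ) : ℂ) * (-1) ^ k))

/-- The series `G_{mn}(x_i, y_j) = ι_{x_i y_j} g_{mn}(x_i, y_j)`. -/
def G {r s : ℕ} (m n : ℕ) (i : Fin r) (j : Fin s) : HahnSeries (Expo r s) ℂ :=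
  iota i j (gDeriv m n)

/-- The determinant of the `ρ × ρ` matrix with entries
`(a_{i_k}, b_{j_l}) G_{m_{i_k} n_{j_l}}(x_{i_k}, y_{j_l})`. -/
def contractionDet {H : Type*} [AddCommGroup H] [Module ℂ H] (B : LinearMap.BilinForm ℂ H)
    {r s : ℕ} (a : Fin r → H) (b : Fin s → H) (m : Fin r → ℕ) (n : Fin s → ℕ)
    {ρ : ℕ} (i : Fin ρ → Fin r) (j : Fin ρ → Fin s) : HahnSeries (Expo r s) ℂ :=
  Matrix.det (Matrix.of fun k l => B (a (i k)) (b (j l)) • G (m (i k)) (n (j l)) (i k) (j l))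

end TwistedFock

end

open scoped TensorProduct

noncomputable section

namespace TwistedFock

/-! The core is one identity for modes, `mode_mul_nord`: multiplying a normal-ordered product on the
left by a mode gives the normal-ordered product with that mode in front, plus the signed sum of its
contractions with the factors. The contraction of $a(k)$ with $b(l)$ is $(a,b)$ times `pairCoeff k
l`, which is $1$ for $k=-l>0$, $1/2$ for $k=l=0$ and $0$ otherwise. A negative mode is already in
place. A positive mode is moved through the negative ones by the anticommutation relation. A zero
mode anticommutes with all nonzero modes, and the recursion for zero modes does the rest. Normal
ordering keeps the order inside each class of modes, so no relation inside a class is needed.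

Wick's theorem for modes follows formally from this identity (`mul_eq_wickSum`). Writing
$F(aA)=a\,F(A)-{}$(contractions of $a$ with $A$) and inducting on the length, the contractions of
$a$ with $A$ cancel and those with the second product remain. The outcome, `wickSum`, is a recursion
on the fate of the first factor: it stays, or it is paired with a factor on the right.
`wickSum_eq_sum_detTerm` turns the recursion into determinants, since choosing the partner of the
first contracted factor is the Laplace expansion along the first row.

To pass to series, coefficients are compared. The variables are distinct, so each coefficient of
each product is a single product of coefficients, and a coefficient of the determinant is the
determinant of coefficients (`coeff_contractionDet`). The contractions match because
$\iota_{xy}g=\frac12x^{-1/2}y^{-1/2}+\sum_{k>0}x^{-k-1/2}y^{k-1/2}$ has the numbers `pairCoeff k l`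
as coefficients (`coeff_iota_g`), while the divided derivatives produce the same binomial
coefficients in $G_{mn}$ as in $a^{(m)}$ and $b^{(n)}$. -/

/-! ### Signed contractions of functions on lists -/

section Contraction

variable {X E : Type*} [AddCommGroup E] [Module ℂ E]

/-- The signed sum `∑ₖ (-1)ᵏ c(Lₖ) G(L without Lₖ)`. -/
def contract (c : X → ℂ) : (List X → E) → List X → E
  | _, [] => 0
  | G, x :: L => c x • G L - contract c (fun L' => G (x :: L')) L

@[simp] theorem contract_nil (c : X → ℂ) (G : List X → E) : contract c G [] = 0 := rfl

theorem contract_cons (c : X → ℂ) (G : List X → E) (x : X) (L : List X) :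
    contract c G (x :: L) = c x • G L - contract c (fun L' => G (x :: L')) L := rfl

theorem contract_add (c : X → ℂ) (G G' : List X → E) (L : List X) :
    contract c (fun L' => G L' + G' L') L = contract c G L + contract c G' L := by
  induction L generalizing G G' with
  | nil => simp
  | cons x L ih => simp only [contract_cons, ih, smul_add]; abel

theorem contract_map {E' : Type*} [AddCommGroup E'] [Module ℂ E'] (c : X → ℂ) (f : E →ₗ[ℂ] E')
    (G : List X → E) (L : List X) :
    contract c (fun L' => f (G L')) L = f (contract c G L) := by
  induction L generalizing G with
  | nil => simp
  | cons x L ih => simp only [contract_cons, ih, map_sub, map_smul]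

theorem contract_smul (c : X → ℂ) (z : ℂ) (G : List X → E) (L : List X) :
    contract c (fun L' => z • G L') L = z • contract c G L :=
  contract_map c (LinearMap.lsmul ℂ E z) G L

theorem contract_sub (c : X → ℂ) (G G' : List X → E) (L : List X) :
    contract c (fun L' => G L' - G' L') L = contract c G L - contract c G' L := by
  induction L generalizing G G' with
  | nil => simp
  | cons x L ih => simp only [contract_cons, ih, smul_sub]; abel

/-- `contract` evaluates its function only on shorter lists with entries from `L`; this lets an
induction hypothesis on the length be used under a contraction. -/
theorem contract_congr (c : X → ℂ) {G G' : List X → E} {L : List X}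
    (h : ∀ L', L'.length < L.length → (∀ x ∈ L', x ∈ L) → G L' = G' L') :
    contract c G L = contract c G' L := by
  induction L generalizing G G' with
  | nil => rfl
  | cons x L ih =>
    rw [contract_cons, contract_cons, h L (by simp) (by simp +contextual), ih]
    intro L' hL' hm
    refine h _ (by simpa using hL') ?_
    intro y hy
    rcases List.mem_cons.1 hy with rfl | hy
    · simp
    · exact List.mem_cons_of_mem _ (hm y hy)

theorem contract_eq_zero {c : X → ℂ} (G : List X → E) {L : List X} (h : ∀ x ∈ L, c x = 0) :
    contract c G L = 0 := by
  induction L generalizing G with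
  | nil => rfl
  | cons x L ih =>
    rw [contract_cons, h x (by simp), zero_smul, ih _ fun y hy => h y (List.mem_cons_of_mem _ hy),
      sub_zero]

theorem contract_sign (c : X → ℂ) (G : List X → E) (L : List X) :
    contract c (fun L' => (-1 : ℂ) ^ L'.length • G L') L =
      -((-1 : ℂ) ^ L.length • contract c G L) := by
  induction L generalizing G with
  | nil => simp
  | cons x L ih =>
    have h : (fun L' => (-1 : ℂ) ^ (x :: L').length • G (x :: L')) =
        fun L' => (-1 : ℂ) ^ L'.length • ((-1 : ℂ) • G (x :: L')) := by
      funext L'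
      rw [List.length_cons, pow_succ, mul_smul]
    rw [contract_cons, h, ih, contract_smul, contract_cons, List.length_cons, pow_succ]
    module

/-- Both sides sum over ordered pairs of deleted entries. Deleting the earlier entry first shifts
the position of the later one by one, whence the opposite sign. -/
theorem contract_anticomm (c d : X → ℂ) (G : List X → E) (L : List X) :
    contract c (contract d G) L = -contract d (contract c G) L := by
  induction L generalizing G with
  | nil => simp
  | cons x L ih =>
    simp only [contract_cons, contract_sub, contract_smul]
    have := ih (fun L' => G (x :: L'))
    rw [this]
    abel

theorem contract_comm {Y : Type*} (c : X → ℂ) (d : Y → ℂ) (K : List X → List Y → E)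
    (A : List X) (B : List Y) :
    contract c (fun A' => contract d (K A') B) A =
      contract d (fun B' => contract c (fun A' => K A' B') A) B := by
  induction A generalizing K with
  | nil =>
    simp only [contract_nil]
    exact ((contract_map d (0 : E →ₗ[ℂ] E) (fun _ => 0) B).trans (by simp)).symm
  | cons x A ih =>
    simp only [contract_cons, contract_sub, contract_smul]
    rw [ih fun A' => K (x :: A')]

/-- This is the shape of the sum in the recursion of `zeroNord`. -/
theorem contract_eq_sum_eraseIdx (c : X → ℂ) (G : List X → E) (L : List X) :
    contract c G L =
      ∑ k : Fin L.length, ((-1 : ℂ) ^ (k : ℕ) * c (L.get k)) • G (L.eraseIdx k) := by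
  induction L generalizing G with
  | nil => simp
  | cons x L ih =>
    rw [contract_cons, ih]
    erw [Fin.sum_univ_succ]
    rw [sub_eq_add_neg, ← Finset.sum_neg_distrib]
    congr 1
    · simp
    · refine Finset.sum_congr rfl fun k _ => ?_
      have h : (x :: L).get k.succ = L.get k := rfl
      simp only [Fin.val_succ, pow_succ, List.eraseIdx_cons_succ]
      erw [h]
      module

/-- Deletion by `Fin.succAbove` is the form in which a determinant is expanded along its first row.
-/
theorem contract_ofFn (c : X → ℂ) (G : List X → E) {s : ℕ} (b : Fin (s + 1) → X) :
    contract c G (List.ofFn b) =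
      ∑ l : Fin (s + 1), ((-1 : ℂ) ^ (l : ℕ) * c (b l)) • G (List.ofFn fun k => b (l.succAbove k)) := by
  induction s generalizing G with
  | zero => simp [contract_cons]
  | succ s ih =>
    rw [List.ofFn_succ, contract_cons, ih,
      Fin.sum_univ_succ (f := fun l : Fin (s + 1 + 1) => ((-1 : ℂ) ^ (l : ℕ) * c (b l)) •
        G (List.ofFn fun k => b (l.succAbove k))), sub_eq_add_neg, ← Finset.sum_neg_distrib]
    congr 1
    · simp
    · refine Finset.sum_congr rfl fun k _ => ?_
      rw [List.ofFn_succ (f := fun t => b (k.succ.succAbove t))]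
      simp only [Fin.val_succ, pow_succ, Fin.succ_succAbove_zero, Fin.succ_succAbove_succ]
      module

/-- The sum of `G` over all ways to contract some elements of `A` with elements of `B`. -/
def wickSum (c : X → X → ℂ) : List X → (List X → E) → List X → E
  | [], G, B => G B
  | a :: A, G, B =>
      wickSum c A (fun L => G (a :: L)) B +
        (-1 : ℂ) ^ A.length • contract (c a) (wickSum c A G) B

theorem wickSum_nil (c : X → X → ℂ) (G : List X → E) (B : List X) : wickSum c [] G B = G B := rfl

theorem wickSum_cons (c : X → X → ℂ) (a : X) (A : List X) (G : List X → E) (B : List X) :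
    wickSum c (a :: A) G B = wickSum c A (fun L => G (a :: L)) B +
      (-1 : ℂ) ^ A.length • contract (c a) (wickSum c A G) B := rfl

theorem wickSum_add (c : X → X → ℂ) (A : List X) (G G' : List X → E) (B : List X) :
    wickSum c A (fun L => G L + G' L) B = wickSum c A G B + wickSum c A G' B := by
  induction A generalizing G G' B with
  | nil => rfl
  | cons a A ih =>
    have h : wickSum c A (fun L => G L + G' L) = fun B => wickSum c A G B + wickSum c A G' B :=
      funext fun B => ih G G' B
    simp only [wickSum_cons, ih, h, contract_add, smul_add]
    abel

theorem wickSum_map {E' : Type*} [AddCommGroup E'] [Module ℂ E'] (c : X → X → ℂ) (A : List X)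
    (f : E →ₗ[ℂ] E') (G : List X → E) (B : List X) :
    wickSum c A (fun L => f (G L)) B = f (wickSum c A G B) := by
  induction A generalizing G B with
  | nil => rfl
  | cons a A ih =>
    have h : wickSum c A (fun L => f (G L)) = fun B => f (wickSum c A G B) :=
      funext fun B => ih G B
    simp only [wickSum_cons, ih, h, contract_map, map_add, map_smul]

theorem wickSum_smul (c : X → X → ℂ) (A : List X) (z : ℂ) (G : List X → E) (B : List X) :
    wickSum c A (fun L => z • G L) B = z • wickSum c A G B :=
  wickSum_map c A (LinearMap.lsmul ℂ E z) G B

theorem wickSum_sub (c : X → X → ℂ) (A : List X) (G G' : List X → E) (B : List X) :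
    wickSum c A (fun L => G L - G' L) B = wickSum c A G B - wickSum c A G' B := by
  rw [eq_sub_iff_add_eq, ← wickSum_add]
  simp

/-- The list passed to `G` consists of the uncontracted entries of `A` followed by those of `B`, so
an extra contraction hits either `A` or `B`. In the second case, with `ρ` contractions present, the
extra one passes `A.length - ρ` remaining entries of `A` and anticommutes with `ρ` contractions,
which gives the sign `(-1) ^ A.length`. -/
theorem wickSum_contract (c : X → X → ℂ) (d : X → ℂ) (A : List X) (G : List X → E) (B : List X) :
    wickSum c A (contract d G) B = contract d (fun A' => wickSum c A' G B) A +
      (-1 : ℂ) ^ A.length • contract d (wickSum c A G) B := by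
  induction A generalizing G B with
  | nil => simp [wickSum_nil, show wickSum c [] G = G from funext fun _ => rfl]
  | cons x A ih =>
    have h1 : wickSum c A (contract d G) = fun B => contract d (fun A' => wickSum c A' G B) A +
        (-1 : ℂ) ^ A.length • contract d (wickSum c A G) B := funext fun B => ih G B
    have h2 : wickSum c (x :: A) G = fun B => wickSum c A (fun L => G (x :: L)) B +
        (-1 : ℂ) ^ A.length • contract (c x) (wickSum c A G) B := rfl
    have h3 : ((-1 : ℂ) ^ A.length) * ((-1 : ℂ) ^ A.length) = 1 := by
      rw [← mul_pow]; simp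
    rw [wickSum_cons, h1, contract_cons, h2]
    simp only [contract_cons, wickSum_sub, wickSum_smul, wickSum_cons, contract_add, contract_smul,
      contract_sign, ih, contract_comm d (c x), List.length_cons, pow_succ,
      contract_anticomm d (c x)]
    simp only [smul_add, smul_neg, smul_smul, mul_neg, mul_one, neg_mul, h3]
    module

/-- Wick's theorem for a function `F` on lists that is defined from left multiplications by
subtracting contractions. -/
theorem mul_eq_wickSum {R : Type*} [Ring R] [Algebra ℂ R] (c : X → X → ℂ) (op : X → R)
    (F : List X → R) (hnil : F [] = 1)
    (hcons : ∀ a L, op a * F L = F (a :: L) + contract (c a) F L) (A B : List X) :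
    F A * F B = wickSum c A F B := by
  -- Induction on the length rather than on the list: contracting inside `A` produces lists that are
  -- not tails of it.
  induction hn : A.length using Nat.strong_induction_on generalizing A with
  | _ n ih =>
  cases A with
  | nil => rw [hnil, one_mul, wickSum_nil]
  | cons a A =>
    subst hn
    have h1 : F (a :: A) * F B = op a * (F A * F B) - contract (c a) F A * F B := by
      rw [← mul_assoc, hcons, add_mul, add_sub_cancel_right]
    have h2 : contract (c a) F A * F B = contract (c a) (fun A' => wickSum c A' F B) A := by
      rw [← LinearMap.mulRight_apply (R := ℂ), ← contract_map]
      refine contract_congr _ fun L' hL' _ => ?_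
      rw [LinearMap.mulRight_apply]
      exact ih _ (by simpa using hL'.trans (Nat.lt_succ_self _)) L' rfl
    rw [h1, h2, ih _ (by simp) A rfl, ← LinearMap.mulLeft_apply (R := ℂ), ← wickSum_map]
    simp only [LinearMap.mulLeft_apply, hcons]
    -- By `wickSum_contract`, the contractions of `a` with entries of `A` cancel the term subtracted
    -- in `h1`, and those with entries of `B` form the second term of `wickSum_cons`.
    rw [wickSum_add c A (fun L => F (a :: L)) (contract (c a) F),
      wickSum_contract c (c a) A F B, wickSum_cons]
    abel

end Contraction

/-! ### Relations between modes -/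

section Modes

variable {H : Type*} [AddCommGroup H] [Module ℂ H] (B : LinearMap.BilinForm ℂ H)

theorem toN_surjective : Function.Surjective (toN B) := RingQuot.mkAlgHom_surjective ℂ (Rel B)

theorem toN_eq_of_rel {x y : TensorAlgebra ℂ (Affinization H)} (h : Rel B x y) :
    toN B x = toN B y := RingQuot.mkAlgHom_rel ℂ h

/-- The defining relations give this for the generators `gen a n`; these and `central H` span the
degree-one part, and commuting with a fixed element is stable under sums, scalars and products. -/
theorem commute_central (x : NAlg B) : Commute x (toN B (central H)) := by
  obtain ⟨x, rfl⟩ := toN_surjective B x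
  induction x using TensorAlgebra.induction with
  | algebraMap z => rw [AlgHom.commutes]; exact Algebra.commutes z _
  | mul x y hx hy => rw [map_mul]; exact hx.mul_left hy
  | add x y hx hy => rw [map_add]; exact hx.add_left hy
  | ι v =>
    obtain ⟨v, w⟩ := v
    have hsplit : TensorAlgebra.ι ℂ ((v, w) : Affinization H) =
        TensorAlgebra.ι ℂ ((v, 0) : Affinization H) + w • central H := by
      rw [central, ← map_smul, ← map_add]
      congr 1
      ext <;> simp
    rw [hsplit, map_add, map_smul]
    refine Commute.add_left ?_ ((Commute.refl _).smul_left w)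
    induction v using TensorProduct.induction_on with
    | zero =>
      have h0 : ((0, 0) : Affinization H) = 0 := rfl
      rw [h0, map_zero, map_zero]
      exact Commute.zero_left _
    | add x y hx hy =>
      have h0 : ((x + y, 0) : Affinization H) = (x, 0) + (y, 0) := by ext <;> simp
      rw [h0, map_add, map_add]
      exact (hx (by rw [central, ← map_smul, ← map_add]; congr 1; ext <;> simp)).add_left
        (hy (by rw [central, ← map_smul, ← map_add]; congr 1; ext <;> simp))
    | tmul a p =>
      clear hsplit
      induction p using LaurentPolynomial.induction_on' with
      | add p q hp hq =>
        have h0 : ((a ⊗ₜ (p + q), 0) : Affinization H) = (a ⊗ₜ p, 0) + (a ⊗ₜ q, 0) := by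
          ext <;> simp [TensorProduct.tmul_add]
        rw [h0, map_add, map_add]
        exact hp.add_left hq
      | C_mul_T n z =>
        have h0 : ((a ⊗ₜ (LaurentPolynomial.C z * LaurentPolynomial.T n), 0) : Affinization H) =
            z • (a ⊗ₜ LaurentPolynomial.T n, 0) := by
          rw [← LaurentPolynomial.smul_eq_C_mul, TensorProduct.tmul_smul]
          ext <;> simp
        rw [h0, map_smul, map_smul]
        refine Commute.smul_left ?_ z
        have h := toN_eq_of_rel B (Rel.comm_central a n)
        rwa [map_mul, map_mul] at h

variable (U : Type*) [AddCommGroup U] [Module ℂ U] [Module (TensorAlgebra ℂ H) U]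

/-- Being central, `𝐤` can be moved past `x` in `x ⊗ u` until it stands next to `U`, where the
relations of the induced module make it `1`. -/
theorem lsmul_central : Algebra.lsmul ℂ ℂ (Fock B U) (toN B (central H)) = 1 := by
  refine LinearMap.ext fun w => ?_
  obtain ⟨t, rfl⟩ := Submodule.Quotient.mk_surjective (inducedRel B U) w
  change Submodule.Quotient.mk (toN B (central H) • t) = Submodule.Quotient.mk t
  induction t using TensorProduct.induction_on with
  | zero => rw [smul_zero]
  | add x y hx hy => rw [smul_add, Submodule.Quotient.mk_add, hx, hy, Submodule.Quotient.mk_add]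
  | tmul x u =>
    rw [Submodule.Quotient.eq]
    have h : toN B (central H) • (x ⊗ₜ[ℂ] u) - x ⊗ₜ[ℂ] u =
        x • (toN B (central H) ⊗ₜ[ℂ] u - (1 : NAlg B) ⊗ₜ[ℂ] u) := by
      rw [smul_sub, TensorProduct.smul_tmul', TensorProduct.smul_tmul', TensorProduct.smul_tmul',
        smul_eq_mul, smul_eq_mul, smul_eq_mul, mul_one, (commute_central B x).eq]
    rw [h]
    exact Submodule.smul_mem _ _ (Submodule.subset_span (Or.inr ⟨u, rfl⟩))

theorem mode_mul_mode_of_pos_of_neg (a b : H) {m n : ℤ} (hm : 0 < m) (hn : n < 0) :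
    mode B U a m * mode B U b n =
      (if m + n = 0 then B a b else 0) • 1 - mode B U b n * mode B U a m := by
  have h := congrArg (Algebra.lsmul ℂ ℂ (Fock B U)) (toN_eq_of_rel B (Rel.pos_neg a b m n hm hn))
  rw [map_add, map_mul, map_mul, map_add, map_mul, map_mul] at h
  rw [eq_sub_iff_add_eq]
  refine h.trans ?_
  split_ifs
  · rw [map_smul, map_smul, lsmul_central]
  · rw [map_zero, map_zero, zero_smul]

theorem mode_mul_mode_of_ne_zero (a b : H) {p : ℤ} (hp : p ≠ 0) :
    mode B U a p * mode B U b 0 = -(mode B U b 0 * mode B U a p) := by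
  have h := congrArg (Algebra.lsmul ℂ ℂ (Fock B U)) (toN_eq_of_rel B (Rel.nonzero_zero a b p hp))
  rw [map_add, map_mul, map_mul, map_add, map_mul, map_mul, map_zero, map_zero] at h
  exact eq_neg_of_add_eq_zero_left h

theorem mode_zero_mul_prod (a : H) (N : List (H × ℤ)) (hN : ∀ x ∈ N, x.2 ≠ 0) :
    mode B U a 0 * (N.map fun x => mode B U x.1 x.2).prod =
      (-1 : ℂ) ^ N.length • ((N.map fun x => mode B U x.1 x.2).prod * mode B U a 0) := by
  induction N with
  | nil => simp
  | cons x N ih =>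
    have h := mode_mul_mode_of_ne_zero B U x.1 a (hN x (by simp))
    rw [← neg_eq_iff_eq_neg] at h
    rw [List.map_cons, List.prod_cons, ← mul_assoc, ← h, neg_mul, mul_assoc,
      ih fun y hy => hN y (List.mem_cons_of_mem _ hy), List.length_cons, pow_succ, mul_smul_comm,
      mul_assoc]
    module

/-- The coefficient of `(a, b)` in the contraction of `a(k)` with `b(l)`. -/
def pairCoeff (k l : ℤ) : ℂ :=
  if k + l = 0 then if k = 0 then 1 / 2 else if 0 < k then 1 else 0 else 0

/-- The contraction of two modes. -/
def modePairing (x y : H × ℤ) : ℂ := B x.1 y.1 * pairCoeff x.2 y.2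

/-- Each exchange of the positive mode with a negative one changes the sign and leaves a scalar,
which is the contraction of the two. -/
theorem mode_pos_mul_prod (x : H × ℤ) (hx : 0 < x.2) (N : List (H × ℤ)) (hN : ∀ y ∈ N, y.2 < 0) :
    mode B U x.1 x.2 * (N.map fun y => mode B U y.1 y.2).prod =
      (-1 : ℂ) ^ N.length • ((N.map fun y => mode B U y.1 y.2).prod * mode B U x.1 x.2) +
        contract (modePairing B x) (fun N => (N.map fun y => mode B U y.1 y.2).prod) N := by
  induction N with
  | nil => simp
  | cons y N ih =>
    have h := mode_mul_mode_of_pos_of_neg B U x.1 y.1 hx (hN y (by simp))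
    have hc : (if x.2 + y.2 = 0 then B x.1 y.1 else 0) = modePairing B x y := by
      unfold modePairing pairCoeff
      split_ifs <;> first | omega | simp
    have h2 : contract (modePairing B x)
        (fun N => ((y :: N).map fun y => mode B U y.1 y.2).prod) N =
        mode B U y.1 y.2 * contract (modePairing B x)
          (fun N => (N.map fun y => mode B U y.1 y.2).prod) N := by
      rw [← LinearMap.mulLeft_apply (R := ℂ), ← contract_map]
      simp only [List.map_cons, List.prod_cons, LinearMap.mulLeft_apply]
    rw [contract_cons, h2, List.map_cons, List.prod_cons, ← mul_assoc, h, hc, sub_mul, mul_assoc,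
      ih fun y hy => hN y (List.mem_cons_of_mem _ hy), List.length_cons, pow_succ, mul_add,
      mul_smul_comm, smul_mul_assoc, one_mul, mul_assoc]
    module

/-- The recursion of `zeroNord` rearranged: its coefficients `(-1) ^ (k + 1) / 2` are the negatives
of the contraction coefficients. Zero modes need not satisfy any relation among themselves. -/
theorem mode_zero_mul_zeroNord (a : H) (l : List H) :
    mode B U a 0 * zeroNord B U l =
      zeroNord B U (a :: l) + contract (fun b => B a b * pairCoeff 0 0) (zeroNord B U) l := by
  rw [contract_eq_sum_eraseIdx, zeroNord, add_assoc, ← Finset.sum_add_distrib,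
    Finset.sum_eq_zero, add_zero]
  intro k _
  rw [← add_smul]
  convert zero_smul ℂ _
  rw [pow_succ, pairCoeff, if_pos (by norm_num), if_pos rfl]
  ring

end Modes

/-! ### The sign of the shuffle -/

section Shuffle

/-- The inversions of the inverse of a stable sort are the pairs `i < j` with `f j < f i`; ties
contribute none. -/
theorem sign_sort {n : ℕ} (f : Fin n → ℕ) :
    Equiv.Perm.sign (Tuple.sort f) = ∏ i, ∏ j ∈ Finset.Ioi i, if f i ≤ f j then 1 else -1 := by
  obtain ⟨h1, h2⟩ := Tuple.eq_sort_iff.1 (rfl : Tuple.sort f = Tuple.sort f)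
  rw [← Equiv.Perm.sign_inv, Equiv.Perm.sign_eq_prod_prod_Ioi]
  refine Finset.prod_congr rfl fun i _ => Finset.prod_congr rfl fun j hj => ?_
  rw [Finset.mem_Ioi] at hj
  congr 1
  rw [eq_iff_iff]
  constructor
  · intro h
    simpa using h1 h.le
  · intro h
    by_contra hlt
    have hne : (Tuple.sort f)⁻¹ j ≠ (Tuple.sort f)⁻¹ i := fun he =>
      hj.ne' ((Tuple.sort f)⁻¹.injective he)
    have hlt' := lt_of_le_of_ne (not_lt.1 hlt) hne
    -- An inversion with `f i ≤ f j` would be a tie, where stability keeps `i` before `j`.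
    have h3 : f j ≤ f i := by simpa using h1 hlt'.le
    have h4 := h2 _ _ hlt' (by simpa using le_antisymm h3 h)
    exact lt_asymm hj (by simpa using h4)

theorem prod_ite_eq_neg_one_pow_countP {X : Type*} (p : X → Prop) [DecidablePred p] (l : List X) :
    (∏ j : Fin l.length, if p (l.get j) then (1 : ℤˣ) else -1) =
      (-1) ^ l.countP fun x => ¬ p x := by
  induction l with
  | nil => simp
  | cons x l ih =>
    erw [Fin.prod_univ_succ]
    rw [List.countP_cons, pow_add, mul_comm, ← ih]
    congr 1
    by_cases h : p x <;> simp [h]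

variable {H : Type*}

/-- A new first entry is inverted exactly with the entries of strictly smaller class; these are the
factors for `i = 0` in `sign_sort`. -/
theorem sign_shuffle_cons (x : H × ℤ) (l : List (H × ℤ)) :
    Equiv.Perm.sign (shuffle (x :: l)) =
      (-1) ^ (l.countP fun y => ¬ modeClass x.2 ≤ modeClass y.2) *
        Equiv.Perm.sign (shuffle l) := by
  rw [shuffle, shuffle, sign_sort, sign_sort,
    ← prod_ite_eq_neg_one_pow_countP fun y : H × ℤ => modeClass x.2 ≤ modeClass y.2]
  erw [Fin.prod_univ_succ]
  congr 1
  · erw [Fin.prod_Ioi_zero]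
    rfl
  · refine Finset.prod_congr rfl fun i _ => ?_
    erw [Fin.prod_Ioi_succ]
    rfl

variable {E : Type*} [AddCommGroup E] [Module ℂ E]

/-- The signed evaluation of a function of three lists at the negative, the positive and the zero
modes of a list. -/
def classSplit (F : List (H × ℤ) → List (H × ℤ) → List (H × ℤ) → E) (l : List (H × ℤ)) : E :=
  ((Equiv.Perm.sign (shuffle l) : ℤ) : ℂ) •
    F (l.filter fun x => x.2 < 0) (l.filter fun x => 0 < x.2) (l.filter fun x => x.2 = 0)

/-- Adding a mode to the list of its class, with the sign for moving it there. -/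
def insertMode (x : H × ℤ) (F : List (H × ℤ) → List (H × ℤ) → List (H × ℤ) → E)
    (N P Z : List (H × ℤ)) : E :=
  if x.2 < 0 then F (x :: N) P Z
  else if 0 < x.2 then (-1 : ℂ) ^ N.length • F N (x :: P) Z
  else (-1 : ℂ) ^ (N.length + P.length) • F N P (x :: Z)

/-- By stability the new entry becomes the head of the list of its class, after passing all entries
of smaller classes. This reduces statements about the shuffle to induction on the list. -/
theorem classSplit_cons (F : List (H × ℤ) → List (H × ℤ) → List (H × ℤ) → E) (x : H × ℤ)
    (l : List (H × ℤ)) : classSplit F (x :: l) = classSplit (insertMode x F) l := by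
  have hs : ((Equiv.Perm.sign (shuffle (x :: l)) : ℤ) : ℂ) =
      ((Equiv.Perm.sign (shuffle l) : ℤ) : ℂ) *
        (-1) ^ (l.countP fun y => ¬ modeClass x.2 ≤ modeClass y.2) := by
    rw [sign_shuffle_cons, mul_comm]
    push_cast
    rfl
  rw [classSplit, classSplit, insertMode, hs, mul_smul]
  congr 1
  rcases lt_trichotomy x.2 0 with hx | hx | hx
  · have hc : (l.countP fun y => ¬ modeClass x.2 ≤ modeClass y.2) = 0 := by
      rw [List.countP_eq_zero]
      simp [modeClass, hx]
    rw [hc, pow_zero, one_smul, if_pos hx, List.filter_cons_of_pos (by simpa using hx),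
      List.filter_cons_of_neg (by simpa using hx.le),
      List.filter_cons_of_neg (by simpa using hx.ne)]
  · have hc : (l.countP fun y => ¬ modeClass x.2 ≤ modeClass y.2) =
        (l.filter fun x => x.2 < 0).length + (l.filter fun x => 0 < x.2).length := by
      induction l with
      | nil => rfl
      | cons y l ih =>
        -- The hypothesis `hs` mentions `l`, so the induction carries it along and it has to be
        -- supplied for the tail.
        rw [List.countP_cons, ih (by rw [sign_shuffle_cons, mul_comm]; push_cast; rfl)]
        rcases lt_trichotomy y.2 0 with hy | hy | hy <;>
          simp [modeClass, hx, hy, hy.not_gt] <;> omega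
    rw [hc, if_neg hx.not_lt, if_neg hx.not_gt, List.filter_cons_of_neg (by simpa using hx.ge),
      List.filter_cons_of_neg (by simpa using hx.le), List.filter_cons_of_pos (by simpa using hx)]
  · have hc : (l.countP fun y => ¬ modeClass x.2 ≤ modeClass y.2) =
        (l.filter fun x => x.2 < 0).length := by
      induction l with
      | nil => rfl
      | cons y l ih =>
        rw [List.countP_cons, ih (by rw [sign_shuffle_cons, mul_comm]; push_cast; rfl)]
        rcases lt_trichotomy y.2 0 with hy | hy | hy <;>
          simp [modeClass, hx, hx.not_gt, hy, hy.not_gt]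
    rw [hc, if_neg hx.not_gt, if_pos hx, List.filter_cons_of_neg (by simpa using hx.le),
      List.filter_cons_of_pos (by simpa using hx), List.filter_cons_of_neg (by simpa using hx.ne')]

/-- The signed contraction of a function of three lists. -/
def contract₃ (c : H × ℤ → ℂ) (F : List (H × ℤ) → List (H × ℤ) → List (H × ℤ) → E)
    (N P Z : List (H × ℤ)) : E :=
  contract c (fun N => F N P Z) N + (-1 : ℂ) ^ N.length • contract c (fun P => F N P Z) P +
    (-1 : ℂ) ^ (N.length + P.length) • contract c (fun Z => F N P Z) Z

/-- The analogue of `contract_cons` for three lists. If `x` itself is contracted, the sign of its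
position cancels its insertion sign. If another entry is contracted, the presence of `x` costs one
sign, through the position of that entry or through the insertion sign of `x`. -/
theorem insertMode_contract₃ (c : H × ℤ → ℂ)
    (F : List (H × ℤ) → List (H × ℤ) → List (H × ℤ) → E) (x : H × ℤ) (N P Z : List (H × ℤ)) :
    insertMode x (contract₃ c F) N P Z =
      c x • F N P Z - contract₃ c (insertMode x F) N P Z := by
  rcases lt_trichotomy x.2 0 with hx | hx | hx
  · simp only [insertMode, contract₃, if_pos hx, contract_cons, List.length_cons, pow_succ,
      pow_add]
    module
  · have e1 : contract c (fun N => (-1 : ℂ) ^ (N.length + P.length) • F N P (x :: Z)) N =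
        -((-1 : ℂ) ^ (N.length + P.length) • contract c (fun N => F N P (x :: Z)) N) := by
      simp only [pow_add, mul_smul]
      rw [contract_sign, contract_smul]
    have e2 : contract c (fun P => (-1 : ℂ) ^ (N.length + P.length) • F N P (x :: Z)) P =
        -((-1 : ℂ) ^ (N.length + P.length) • contract c (fun P => F N P (x :: Z)) P) := by
      simp only [pow_add, mul_smul]
      rw [contract_smul, contract_sign, smul_neg]
    simp only [insertMode, contract₃, hx, lt_irrefl, if_false, contract_cons, e1, e2,
      contract_smul]
    rcases neg_one_pow_eq_or ℂ N.length with h1 | h1 <;>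
      rcases neg_one_pow_eq_or ℂ P.length with h2 | h2 <;> rw [pow_add, h1, h2] <;> module
  · have e1 : contract c (fun N => (-1 : ℂ) ^ N.length • F N (x :: P) Z) N =
        -((-1 : ℂ) ^ N.length • contract c (fun N => F N (x :: P) Z) N) := contract_sign _ _ _
    simp only [insertMode, contract₃, if_neg hx.not_gt, if_pos hx, contract_cons, e1,
      contract_smul, List.length_cons]
    rcases neg_one_pow_eq_or ℂ N.length with h1 | h1 <;> rw [← add_assoc, pow_succ, pow_add, h1] <;>
      module

/-- Contracting commutes with sorting: the change in the shuffle sign when an entry is deleted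
accounts for the difference between its positions in `l` and in the sorted list. -/
theorem contract_classSplit (c : H × ℤ → ℂ)
    (F : List (H × ℤ) → List (H × ℤ) → List (H × ℤ) → E) (l : List (H × ℤ)) :
    contract c (classSplit F) l = classSplit (contract₃ c F) l := by
  induction l generalizing F with
  | nil => simp [classSplit, contract₃]
  | cons x l ih =>
    have h : (fun l' => classSplit F (x :: l')) = classSplit (insertMode x F) :=
      funext fun l' => classSplit_cons F x l'
    rw [contract_cons, h, ih, classSplit_cons]
    unfold classSplit
    rw [insertMode_contract₃, smul_sub, smul_comm]

end Shuffle

/-! ### Left multiplication of a normal-ordered product by a mode -/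

section Nord

variable {H : Type*} [AddCommGroup H] [Module ℂ H] (B : LinearMap.BilinForm ℂ H)
  (U : Type*) [AddCommGroup U] [Module ℂ U] [Module (TensorAlgebra ℂ H) U]

theorem nord_eq_classSplit : nord B U = classSplit fun N P Z =>
    (N.map fun x => mode B U x.1 x.2).prod * (P.map fun x => mode B U x.1 x.2).prod *
      zeroNord B U (Z.map Prod.fst) := rfl

theorem contract_comp_map {X Y E : Type*} [AddCommGroup E] [Module ℂ E] (c : X → ℂ) (d : Y → ℂ)
    (f : X → Y) (G : List Y → E) (L : List X) (h : ∀ x ∈ L, c x = d (f x)) :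
    contract c (fun L' => G (L'.map f)) L = contract d G (L.map f) := by
  induction L generalizing G with
  | nil => rfl
  | cons x L ih =>
    rw [contract_cons, List.map_cons, contract_cons, h x (by simp)]
    congr 1
    exact ih (fun L' => G (f x :: L')) fun y hy => h y (List.mem_cons_of_mem _ hy)

/-- In each of the three classes of `x`, at most one class of factors can be contracted with `x`,
and moving `x` to the head of its own class produces precisely these contractions. -/
theorem mode_mul_nord (x : H × ℤ) (l : List (H × ℤ)) :
    mode B U x.1 x.2 * nord B U l =
      nord B U (x :: l) + contract (modePairing B x) (nord B U) l := by
  rw [nord_eq_classSplit, classSplit_cons, contract_classSplit]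
  unfold classSplit
  rw [mul_smul_comm, ← smul_add]
  congr 1
  have hN : ∀ y ∈ l.filter fun x => x.2 < 0, y.2 < 0 := fun y hy => by
    simpa using (List.mem_filter.1 hy).2
  have hP : ∀ y ∈ l.filter fun x => 0 < x.2, 0 < y.2 := fun y hy => by
    simpa using (List.mem_filter.1 hy).2
  have hZ : ∀ y ∈ l.filter fun x => x.2 = 0, y.2 = 0 := fun y hy => by
    simpa using (List.mem_filter.1 hy).2
  generalize (l.filter fun x => x.2 < 0) = N at *
  generalize (l.filter fun x => 0 < x.2) = P at *
  generalize (l.filter fun x => x.2 = 0) = Z at *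
  -- Hence a negative mode has no contractions, a zero mode only those with zero modes, and a
  -- positive mode only those with negative modes.
  have hpair : ∀ y : H × ℤ, x.2 + y.2 ≠ 0 ∨ x.2 < 0 → modePairing B x y = 0 := by
    intro y hy
    unfold modePairing pairCoeff
    split_ifs <;> first | omega | simp
  rcases lt_trichotomy x.2 0 with hx | hx | hx
  · rw [insertMode, if_pos hx, contract₃, contract_eq_zero _ fun y _ => hpair y (Or.inr hx),
      contract_eq_zero _ fun y _ => hpair y (Or.inr hx),
      contract_eq_zero _ fun y _ => hpair y (Or.inr hx)]
    simp [mul_assoc]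
  · have hz : contract (modePairing B x) (fun Z =>
        (N.map fun x => mode B U x.1 x.2).prod * (P.map fun x => mode B U x.1 x.2).prod *
          zeroNord B U (Z.map Prod.fst)) Z =
        (N.map fun x => mode B U x.1 x.2).prod * (P.map fun x => mode B U x.1 x.2).prod *
          contract (fun b => B x.1 b * pairCoeff 0 0) (zeroNord B U) (Z.map Prod.fst) := by
      rw [← contract_comp_map (modePairing B x) _ Prod.fst _ Z fun y hy => by
          rw [modePairing, hx, hZ y hy]]
      exact contract_map (modePairing B x) (LinearMap.mulLeft ℂ _)
        (fun Z => zeroNord B U (Z.map Prod.fst)) Z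
    rw [insertMode, if_neg hx.not_lt, if_neg hx.not_gt, contract₃, hz,
      contract_eq_zero _ fun y hy => hpair y (Or.inl (by have := hN y hy; omega)),
      contract_eq_zero _ fun y hy => hpair y (Or.inl (by have := hP y hy; omega)),
      smul_zero, zero_add, zero_add, ← smul_add, List.map_cons, ← mul_add,
      ← mode_zero_mul_zeroNord, hx, ← mul_assoc, ← mul_assoc,
      mode_zero_mul_prod B U x.1 N fun y hy => (hN y hy).ne, smul_mul_assoc, smul_mul_assoc,
      mul_assoc _ (mode B U x.1 0),
      mode_zero_mul_prod B U x.1 P fun y hy => (hP y hy).ne', pow_add, mul_smul]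
    simp only [mul_smul_comm, smul_mul_assoc, mul_assoc]
  · have hn : contract (modePairing B x) (fun N =>
        (N.map fun x => mode B U x.1 x.2).prod * (P.map fun x => mode B U x.1 x.2).prod *
          zeroNord B U (Z.map Prod.fst)) N =
        contract (modePairing B x) (fun N => (N.map fun x => mode B U x.1 x.2).prod) N *
          ((P.map fun x => mode B U x.1 x.2).prod * zeroNord B U (Z.map Prod.fst)) := by
      rw [← LinearMap.mulRight_apply (R := ℂ), ← contract_map]
      simp only [LinearMap.mulRight_apply, mul_assoc]
    rw [insertMode, if_neg hx.not_gt, if_pos hx, contract₃, hn,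
      contract_eq_zero (L := P) _ fun y hy => hpair y (Or.inl (by have := hP y hy; omega)),
      contract_eq_zero (L := Z) _ fun y hy => hpair y (Or.inl (by have := hZ y hy; omega)),
      smul_zero, smul_zero, add_zero, add_zero, ← mul_assoc, ← mul_assoc,
      mode_pos_mul_prod B U x hx N hN, add_mul, add_mul]
    simp only [List.map_cons, List.prod_cons, smul_mul_assoc, mul_assoc]

theorem nord_mul_nord (A L : List (H × ℤ)) :
    nord B U A * nord B U L = wickSum (modePairing B) A (nord B U) L := by
  refine mul_eq_wickSum (modePairing B) (fun x => mode B U x.1 x.2) (nord B U) ?_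
    (mode_mul_nord B U) A L
  rw [nord_eq_classSplit, classSplit]
  have h : shuffle ([] : List (H × ℤ)) = 1 := Equiv.ext fun i => i.elim0
  simp [zeroNord, h]

end Nord

/-! ### Sums over strictly increasing maps -/

section StrictMonoSums

variable {E : Type*} [AddCommGroup E]

-- An increasing sequence either avoids `0`, and is then a shifted one, or starts with `0`. In
-- Wick's theorem this decides whether the first factor is contracted.
open Classical in
theorem sum_strictMono_succ {ρ r : ℕ} (f : (Fin (ρ + 1) → Fin (r + 1)) → E) :
    ∑ i with StrictMono i, f i =
      ∑ i : Fin (ρ + 1) → Fin r with StrictMono i, f (fun k => (i k).succ) +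
        ∑ i : Fin ρ → Fin r with StrictMono i,
          f (Fin.cons 0 fun k => (i k).succ : Fin (ρ + 1) → Fin (r + 1)) := by
  rw [← Finset.sum_filter_not_add_sum_filter (Finset.univ.filter StrictMono) (fun i => i 0 = 0) f]
  congr 1
  · symm
    refine Finset.sum_nbij (fun i k => (i k).succ) ?_ ?_ ?_ fun _ _ => rfl
    · intro i hi
      simp only [Finset.mem_filter, Finset.mem_univ, true_and] at hi ⊢
      exact ⟨fun k l h => Fin.succ_lt_succ_iff.2 (hi h), Fin.succ_ne_zero _⟩
    · intro i _ i' _ h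
      funext k
      exact Fin.succ_injective _ (congrFun h k)
    · intro i hi
      simp only [Finset.coe_filter, Finset.mem_univ, true_and, Finset.mem_filter,
        Set.mem_ofPred_eq] at hi
      have h : ∀ k, ∃ y, Fin.succ y = i k := fun k => Fin.exists_succ_eq.2 <|
        Fin.pos_iff_ne_zero.1 <| (Fin.pos_iff_ne_zero.2 hi.2).trans_le (hi.1.monotone (Fin.zero_le k))
      choose i' hi' using h
      refine ⟨i', ?_, funext hi'⟩
      simp only [Finset.coe_filter, Finset.mem_univ, true_and, Set.mem_ofPred_eq]
      intro k l hkl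
      rw [← Fin.succ_lt_succ_iff, hi', hi']
      exact hi.1 hkl
  · symm
    refine Finset.sum_nbij (fun i => (Fin.cons 0 fun k => (i k).succ : Fin (ρ + 1) → Fin (r + 1)))
      ?_ ?_ ?_ fun _ _ => rfl
    · intro i hi
      simp only [Finset.mem_filter, Finset.mem_univ, true_and] at hi ⊢
      refine ⟨fun k l hkl => ?_, rfl⟩
      induction l using Fin.cases with
      | zero => exact absurd hkl (Fin.not_lt_zero k)
      | succ l =>
        induction k using Fin.cases with
        | zero => simp
        | succ k =>
          rw [Fin.cons_succ, Fin.cons_succ, Fin.succ_lt_succ_iff]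
          exact hi (Fin.succ_lt_succ_iff.1 hkl)
    · intro i _ i' _ h
      funext k
      simpa using congrFun h k.succ
    · intro i hi
      simp only [Finset.coe_filter, Finset.mem_univ, true_and, Finset.mem_filter,
        Set.mem_ofPred_eq] at hi
      have h : ∀ k : Fin ρ, ∃ y, Fin.succ y = i k.succ := fun k => Fin.exists_succ_eq.2 <|
        Fin.pos_iff_ne_zero.1 <| (Fin.zero_le (i 0)).trans_lt (hi.1 (Fin.succ_pos k))
      choose i' hi' using h
      refine ⟨i', ?_, ?_⟩
      · simp only [Finset.coe_filter, Finset.mem_univ, true_and, Set.mem_ofPred_eq]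
        intro k l hkl
        rw [← Fin.succ_lt_succ_iff, hi', hi']
        exact hi.1 (Fin.succ_lt_succ_iff.2 hkl)
      · funext k
        induction k using Fin.cases with
        | zero => simp [hi.2]
        | succ k => simp [hi']

/-- Pairs of a strictly increasing map `j` and an argument `t` correspond to pairs of a value
`l = j t` and a strictly increasing map into the complement of `l`. -/
theorem exists_strictMono_insert {ρ s : ℕ} (l : Fin (s + 1)) (j' : Fin ρ → Fin s)
    (hj' : StrictMono j') : ∃ (j : Fin (ρ + 1) → Fin (s + 1)) (t : Fin (ρ + 1)), StrictMono j ∧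
      j t = l ∧ ∀ k, j (t.succAbove k) = l.succAbove (j' k) := by
  classical
  set S : Finset (Fin (s + 1)) := insert l (Finset.univ.image fun k => l.succAbove (j' k)) with hS
  have hmono : StrictMono fun k => l.succAbove (j' k) := (Fin.strictMono_succAbove l).comp hj'
  have hcard : S.card = ρ + 1 := by
    rw [hS, Finset.card_insert_of_notMem (by simp [Fin.succAbove_ne]),
      Finset.card_image_of_injective _ hmono.injective, Finset.card_univ, Fintype.card_fin]
  have hrange : Set.range (S.orderEmbOfFin hcard) = S := Finset.range_orderEmbOfFin S hcard
  obtain ⟨t, ht⟩ : l ∈ Set.range (S.orderEmbOfFin hcard) := by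
    rw [hrange, hS]; simp
  refine ⟨S.orderEmbOfFin hcard, t, (S.orderEmbOfFin hcard).strictMono, ht, ?_⟩
  have hmono' : StrictMono fun k => S.orderEmbOfFin hcard (t.succAbove k) :=
    (S.orderEmbOfFin hcard).strictMono.comp (Fin.strictMono_succAbove t)
  refine congrFun ((StrictMono.range_inj hmono' hmono).1 ?_)
  ext x
  constructor
  · rintro ⟨k, rfl⟩
    rcases Finset.mem_insert.1 (Finset.orderEmbOfFin_mem S hcard (t.succAbove k)) with hx | hx
    · rw [← ht] at hx
      exact absurd ((S.orderEmbOfFin hcard).injective hx) (Fin.succAbove_ne t k)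
    · simpa using hx
  · rintro ⟨k, rfl⟩
    have hx : l.succAbove (j' k) ∈ Set.range (S.orderEmbOfFin hcard) := by
      rw [hrange, hS]; simp
    obtain ⟨u, hu⟩ := hx
    have hne : u ≠ t := by
      rintro rfl
      exact Fin.succAbove_ne l (j' k) (hu.symm.trans ht)
    obtain ⟨v, rfl⟩ := Fin.exists_succAbove_eq hne
    exact ⟨v, hu⟩

-- Reindexes a sum of first-row Laplace expansions over all column sets: a column set with a marked
-- column `t` is the same as a column `l` with a column set in its complement.
open Classical in
theorem sum_strictMono_sum_eq {ρ s : ℕ} (f : (Fin (ρ + 1) → Fin (s + 1)) → Fin (ρ + 1) → E)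
    (g : Fin (s + 1) → (Fin ρ → Fin s) → E)
    (h : ∀ j t j', StrictMono j → StrictMono j' →
      (∀ k, j (t.succAbove k) = (j t).succAbove (j' k)) → f j t = g (j t) j') :
    ∑ j with StrictMono j, ∑ t, f j t = ∑ l, ∑ j' with StrictMono j', g l j' := by
  rw [← Finset.sum_product', ← Finset.sum_product']
  have key : ∀ p ∈ (Finset.univ.filter StrictMono : Finset (Fin (ρ + 1) → Fin (s + 1))) ×ˢ
      (Finset.univ : Finset (Fin (ρ + 1))), ∃ j' : Fin ρ → Fin s, StrictMono j' ∧
        ∀ k, p.1 (p.2.succAbove k) = (p.1 p.2).succAbove (j' k) := by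
    rintro ⟨j, t⟩ hp
    have hj : StrictMono j := by simpa using hp
    have h1 : ∀ k, ∃ y, (j t).succAbove y = j (t.succAbove k) := fun k =>
      Fin.exists_succAbove_eq (hj.injective.ne (Fin.succAbove_ne t k))
    choose j' hj' using h1
    refine ⟨j', fun k l hkl => ?_, fun k => (hj' k).symm⟩
    rw [← (Fin.strictMono_succAbove (j t)).lt_iff_lt, hj', hj']
    exact hj (Fin.strictMono_succAbove t hkl)
  refine Finset.sum_bij (fun p hp => (p.1 p.2, (key p hp).choose)) ?_ ?_ ?_ ?_
  · intro p hp
    simpa using (key p hp).choose_spec.1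
  · rintro ⟨j₁, t₁⟩ hp₁ ⟨j₂, t₂⟩ hp₂ he
    obtain ⟨hl, hj⟩ := Prod.mk.inj he
    have e₁ := (key _ hp₁).choose_spec.2
    have e₂ := (key _ hp₂).choose_spec.2
    rw [← hj] at e₂
    have hm₁ : StrictMono j₁ := by simpa using hp₁
    have hm₂ : StrictMono j₂ := by simpa using hp₂
    dsimp only at hl e₁ e₂
    -- The pair determines the range of `j`, and a strictly increasing map is determined by its
    -- range.
    have hsub : ∀ (j j' : Fin (ρ + 1) → Fin (s + 1)) (t t' : Fin (ρ + 1)), j t = j' t' →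
        (∀ k, j (t.succAbove k) = j' (t'.succAbove k)) → Set.range j ⊆ Set.range j' := by
      rintro j j' t t' h1 h2 _ ⟨u, rfl⟩
      by_cases hu : u = t
      · exact ⟨t', by rw [hu, h1]⟩
      · obtain ⟨v, rfl⟩ := Fin.exists_succAbove_eq hu
        exact ⟨_, (h2 v).symm⟩
    have h12 : ∀ k, j₁ (t₁.succAbove k) = j₂ (t₂.succAbove k) := by
      intro k
      have h1 := e₁ k
      have h2 := e₂ k
      generalize (key (j₁, t₁) hp₁).choose = j' at h1 h2
      rw [h1, h2, hl]
    have hj12 : j₁ = j₂ := (StrictMono.range_inj hm₁ hm₂).1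
      (Set.Subset.antisymm (hsub _ _ _ _ hl h12) (hsub _ _ _ _ hl.symm fun k => (h12 k).symm))
    subst hj12
    rw [hm₁.injective hl]
  · rintro ⟨l, j'⟩ hp
    have hj' : StrictMono j' := by simpa using hp
    obtain ⟨j, t, hj, rfl, hjj⟩ := exists_strictMono_insert l j' hj'
    have hm : (j, t) ∈ (Finset.univ.filter StrictMono : Finset (Fin (ρ + 1) → Fin (s + 1))) ×ˢ
      (Finset.univ : Finset (Fin (ρ + 1))) := by simpa using hj
    refine ⟨(j, t), hm, ?_⟩
    refine Prod.ext rfl (funext fun k => ?_)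
    have := (key _ hm).choose_spec.2 k
    dsimp only at this
    rw [hjj] at this
    exact (Fin.succAbove_right_injective this).symm
  · rintro ⟨j, t⟩ hp
    exact h j t _ (by simpa using hp) (key _ hp).choose_spec.1 (key _ hp).choose_spec.2

open Classical in
theorem sum_strictMono_of_lt {ρ r : ℕ} (h : r < ρ) (f : (Fin ρ → Fin r) → E) :
    ∑ i with StrictMono i, f i = 0 := by
  refine Finset.sum_eq_zero fun i hi => absurd (Fintype.card_le_of_injective i ?_) (by simpa using h)
  exact (Finset.mem_filter.1 hi).2.injective

end StrictMonoSums

/-! ### The contraction sum as a sum of determinants -/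

section DetSum

variable {X : Type*}

open Classical in
/-- The values of a finite sequence, with those at the indices in `I` omitted. -/
def omitList {r : ℕ} (A : Fin r → X) (I : Finset (Fin r)) : List X :=
  ((List.finRange r).filter fun i => i ∉ I).map A

theorem omitList_empty {r : ℕ} (A : Fin r → X) : omitList A ∅ = List.ofFn A := by
  rw [omitList, List.filter_eq_self.2 (by simp), List.ofFn_eq_map]

theorem omitList_succ_of_notMem {r : ℕ} (A : Fin (r + 1) → X) {I : Finset (Fin (r + 1))}
    {I' : Finset (Fin r)} (h0 : 0 ∉ I) (h : ∀ x, x.succ ∈ I ↔ x ∈ I') :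
    omitList A I = A 0 :: omitList (fun k => A k.succ) I' := by
  rw [omitList, omitList, List.finRange_succ, List.filter_cons_of_pos (by simpa using h0),
    List.filter_map, List.map_cons, List.map_map]
  congr 2
  refine List.filter_congr fun x _ => ?_
  simp [h]

theorem omitList_succAbove {s : ℕ} (A : Fin (s + 1) → X) (l : Fin (s + 1))
    {J : Finset (Fin (s + 1))} {J' : Finset (Fin s)} (hl : l ∈ J)
    (h : ∀ x, l.succAbove x ∈ J ↔ x ∈ J') :
    omitList A J = omitList (fun k => A (l.succAbove k)) J' := by
  classical
  -- Both lists are strictly increasing and have the same entries.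
  have key : (List.finRange (s + 1)).filter (fun x => x ≠ l) =
      (List.finRange s).map l.succAbove := by
    refine List.Perm.eq_of_pairwise' (r := (· < ·)) ?_ ?_ ?_
    · exact (List.pairwise_lt_finRange _).filter _
    · rw [List.pairwise_map]
      exact (List.pairwise_lt_finRange _).imp fun h => Fin.strictMono_succAbove l h
    · rw [List.perm_ext_iff_of_nodup ((List.nodup_finRange _).filter _)
        ((List.nodup_finRange _).map Fin.succAbove_right_injective)]
      intro x
      simp only [List.mem_filter, List.mem_finRange, true_and, List.mem_map, decide_eq_true_eq]
      exact ⟨fun hx => Fin.exists_succAbove_eq hx, by rintro ⟨y, rfl⟩; exact Fin.succAbove_ne l y⟩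
  have h2 : (List.finRange (s + 1)).filter (fun x => x ∉ J) =
      ((List.finRange (s + 1)).filter fun x => x ≠ l).filter fun x => x ∉ J := by
    rw [List.filter_filter]
    refine List.filter_congr fun x _ => ?_
    by_cases hx : x = l
    · simp [hx, hl]
    · simp [hx]
  have h3 : omitList A J = ((List.finRange (s + 1)).filter fun x => x ∉ J).map A := by
    unfold omitList; congr!
  rw [h3, h2, key, List.filter_map, List.map_map, omitList]
  congr 1
  refine List.filter_congr fun x _ => ?_
  simp [h]

/-- The sign of a contraction of the factors `i` of a product of `r` factors with the factors `j` of
a second product. -/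
def contractionSign (r : ℕ) {ρ r' s : ℕ} (i : Fin ρ → Fin r') (j : Fin ρ → Fin s) : ℂ :=
  (-1 : ℂ) ^ (∑ k, ((i k : ℕ) + 1) + ∑ k, ((j k : ℕ) + 1)) * (-1) ^ (r * ρ + ρ * (ρ + 1) / 2)

variable {E : Type*} [AddCommGroup E] [Module ℂ E]

open Classical in
/-- The contribution to the contraction sum of the contractions between the factors `i` of the first
and the factors `j` of the second product. -/
def detTerm (c : X → X → ℂ) {ρ r s : ℕ} (A : Fin r → X) (b : Fin s → X) (G : List X → E)
    (i : Fin ρ → Fin r) (j : Fin ρ → Fin s) : E :=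
  (contractionSign r i j * Matrix.det (Matrix.of fun k l => c (A (i k)) (b (j l)))) •
    G (omitList A (Finset.univ.image i) ++ omitList b (Finset.univ.image j))

/-- The contractions that leave the first factor alone come from those of the remaining factors,
with the same sign. -/
theorem detTerm_succ (c : X → X → ℂ) {ρ r s : ℕ} (A : Fin (r + 1) → X) (b : Fin s → X)
    (G : List X → E) (i : Fin ρ → Fin r) (j : Fin ρ → Fin s) :
    detTerm c A b G (fun k => (i k).succ) j =
      detTerm c (fun k => A k.succ) b (fun L => G (A 0 :: L)) i j := by
  have hs : contractionSign (r + 1) (fun k => (i k).succ) j = contractionSign r i j := by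
    have h : ∑ k, (((i k).succ : ℕ) + 1) = ∑ k, ((i k : ℕ) + 1) + ρ := by
      simp [Finset.sum_add_distrib]
    rw [contractionSign, contractionSign, h, ← pow_add, ← pow_add]
    -- Shifting the `ρ` indices adds `ρ` to the exponent, and replacing `r` by `r + 1` adds another
    -- `ρ`.
    have h2 : (∑ k, ((i k : ℕ) + 1) + ρ + ∑ k, ((j k : ℕ) + 1) + ((r + 1) * ρ + ρ * (ρ + 1) / 2)) =
        (∑ k, ((i k : ℕ) + 1) + ∑ k, ((j k : ℕ) + 1) + (r * ρ + ρ * (ρ + 1) / 2)) + 2 * ρ := by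
      ring
    rw [h2, pow_add _ _ (2 * ρ), pow_mul]
    simp
  rw [detTerm, detTerm, hs, omitList_succ_of_notMem (I' := Finset.univ.image i) A]
  · rfl
  · simp [Fin.succ_ne_zero]
  · simp

-- The contractions that involve the first factor: the determinant is expanded along its first row,
-- and the marked column is the partner of that factor. The work lies in the sign.
open Classical in
theorem sum_detTerm_cons (c : X → X → ℂ) {ρ r s : ℕ} (A : Fin (r + 1) → X) (b : Fin (s + 1) → X)
    (G : List X → E) (i : Fin ρ → Fin r) :
    ∑ j with StrictMono j, detTerm c A b G
        (Fin.cons 0 fun k => (i k).succ : Fin (ρ + 1) → Fin (r + 1)) j =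
      (-1 : ℂ) ^ r • ∑ l : Fin (s + 1), ((-1 : ℂ) ^ (l : ℕ) * c (A 0) (b l)) •
        ∑ j' with StrictMono j',
          detTerm c (fun k => A k.succ) (fun k => b (l.succAbove k)) G i j' := by
  simp only [Finset.smul_sum]
  rw [← sum_strictMono_sum_eq (fun j t => (contractionSign (r + 1)
      (Fin.cons 0 fun k => (i k).succ : Fin (ρ + 1) → Fin (r + 1)) j * ((-1) ^ (t : ℕ) *
        c (A 0) (b (j t)) *
          Matrix.det (Matrix.of fun k l => c (A (i k).succ) (b (j (t.succAbove l)))))) •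
      G (omitList A (Finset.univ.image
        (Fin.cons 0 fun k => (i k).succ : Fin (ρ + 1) → Fin (r + 1))) ++
          omitList b (Finset.univ.image j)))]
  · refine Finset.sum_congr rfl fun j _ => ?_
    rw [detTerm, Matrix.det_succ_row_zero, Finset.mul_sum, Finset.sum_smul]
    rfl
  · intro j t j' hj hj' h
    have hA : omitList A (Finset.univ.image
        (Fin.cons 0 fun k => (i k).succ : Fin (ρ + 1) → Fin (r + 1))) =
        omitList (fun k => A k.succ) (Finset.univ.image i) := by
      refine (omitList_succAbove A 0 ?_ ?_).trans (by simp only [Fin.succAbove_zero]; rfl)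
      · exact Finset.mem_image.2 ⟨0, by simp, rfl⟩
      · intro x
        simp only [Finset.mem_image, Finset.mem_univ, true_and, Fin.exists_fin_succ, Fin.cons_zero,
          Fin.cons_succ, Fin.succAbove_zero, Fin.succ_inj]
        simp [(Fin.succ_ne_zero x).symm]
    have hb : omitList b (Finset.univ.image j) =
        omitList (fun k => b ((j t).succAbove k)) (Finset.univ.image j') := by
      refine omitList_succAbove b (j t) (by simp) fun x => ?_
      simp only [Finset.mem_image, Finset.mem_univ, true_and]
      constructor
      · rintro ⟨u, hu⟩
        have hut : u ≠ t := by
          rintro rfl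
          exact Fin.succAbove_ne _ _ hu.symm
        obtain ⟨v, rfl⟩ := Fin.exists_succAbove_eq hut
        rw [h] at hu
        exact ⟨v, Fin.succAbove_right_injective hu⟩
      · rintro ⟨v, rfl⟩
        exact ⟨_, h v⟩
    -- Since `j` is increasing, skipping the value `j t` raises `j' k` exactly when skipping the
    -- position `t` raises `k`. Summed over `k`, this compares the index sums of `j` and `j'` in
    -- `hJ`.
    have hpoint : ∀ k, ((j t).succAbove (j' k) : ℕ) + k = j' k + (t.succAbove k : ℕ) := by
      intro k
      have hk := h k
      rcases lt_or_ge k.castSucc t with hlt | hge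
      · have h1 := hj (Fin.succAbove_of_castSucc_lt t k hlt ▸ hlt : t.succAbove k < t)
        rw [hk, Fin.succAbove_lt_iff_castSucc_lt] at h1
        rw [Fin.succAbove_of_castSucc_lt _ _ h1, Fin.succAbove_of_castSucc_lt _ _ hlt]
        simp
      · have h1 := hj ((Fin.lt_succAbove_iff_le_castSucc t k).2 hge)
        rw [hk, Fin.lt_succAbove_iff_le_castSucc] at h1
        rw [Fin.succAbove_of_le_castSucc _ _ h1, Fin.succAbove_of_le_castSucc _ _ hge]
        simp
        omega
    have hsum := Finset.sum_congr (rfl : (Finset.univ : Finset (Fin ρ)) = _) fun k _ => hpoint k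
    rw [Finset.sum_add_distrib, Finset.sum_add_distrib] at hsum
    have hall : (t : ℕ) + ∑ k, (t.succAbove k : ℕ) = ∑ k : Fin ρ, (k : ℕ) + ρ := by
      rw [← Fin.sum_univ_succAbove (fun u : Fin (ρ + 1) => (u : ℕ)) t, Fin.sum_univ_castSucc]
      simp
    have hJ : ∑ k, ((j k : ℕ) + 1) + t = (j t : ℕ) + 1 + ∑ k, ((j' k : ℕ) + 1) + ρ := by
      rw [Fin.sum_univ_succAbove _ t]
      simp only [h, Finset.sum_add_distrib]
      omega
    have hI : ∑ k, (((Fin.cons 0 fun k => (i k).succ : Fin (ρ + 1) → Fin (r + 1)) k : ℕ) + 1) =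
        1 + (∑ k, ((i k : ℕ) + 1) + ρ) := by
      rw [Fin.sum_univ_succ]
      simp [Finset.sum_add_distrib]
    have hT : (ρ + 1) * (ρ + 1 + 1) / 2 = ρ * (ρ + 1) / 2 + (ρ + 1) := by
      rw [show (ρ + 1) * (ρ + 1 + 1) = ρ * (ρ + 1) + (ρ + 1) * 2 by ring,
        Nat.add_mul_div_right _ _ (by norm_num)]
    have hsign : contractionSign (r + 1)
        (Fin.cons 0 fun k => (i k).succ : Fin (ρ + 1) → Fin (r + 1)) j * (-1) ^ (t : ℕ) =
        (-1) ^ r * (-1) ^ (j t : ℕ) * contractionSign r i j' := by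
      rw [contractionSign, contractionSign, ← pow_add, ← pow_add, ← pow_add, ← pow_add,
        ← pow_add, hI, hT]
      -- The two exponents differ by an even number.
      have hexp : 1 + (∑ k, ((i k : ℕ) + 1) + ρ) + ∑ k, ((j k : ℕ) + 1) +
          ((r + 1) * (ρ + 1) + (ρ * (ρ + 1) / 2 + (ρ + 1))) + t =
          (r + (j t : ℕ) + (∑ k, ((i k : ℕ) + 1) + ∑ k, ((j' k : ℕ) + 1) +
            (r * ρ + ρ * (ρ + 1) / 2))) + 2 * (2 * ρ + 2) := by
        have e : (r + 1) * (ρ + 1) = r * ρ + r + ρ + 1 := by ring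
        rw [e]
        omega
      rw [hexp, pow_add _ _ (2 * (2 * ρ + 2)), pow_mul]
      simp
    simp only [detTerm, h]
    rw [hA, hb, smul_smul, smul_smul]
    congr 1
    linear_combination (c (A 0) (b (j t)) * Matrix.det (Matrix.of fun k l => c (A (i k).succ)
      (b ((j t).succAbove (j' l))))) * hsign

-- Induction on `r`: the two terms of `wickSum_cons` correspond to the index sequences `i` that
-- avoid `0` and to those that start with it.
open Classical in
theorem wickSum_eq_sum_detTerm (c : X → X → ℂ) {r s : ℕ} (A : Fin r → X) (b : Fin s → X)
    (G : List X → E) : wickSum c (List.ofFn A) G (List.ofFn b) =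
      ∑ ρ ∈ Finset.range (r + 1), ∑ i : Fin ρ → Fin r with StrictMono i,
        ∑ j : Fin ρ → Fin s with StrictMono j, detTerm c A b G i j := by
  have hzero : ∀ {r s : ℕ} (A : Fin r → X) (b : Fin s → X) (G : List X → E)
      (i : Fin 0 → Fin r) (j : Fin 0 → Fin s),
      detTerm c A b G i j = G (List.ofFn A ++ List.ofFn b) := by
    intro r s A b G i j
    simp [detTerm, contractionSign, omitList_empty]
  have hmono : ∀ {r : ℕ} (i : Fin 0 → Fin r), StrictMono i := fun i k => k.elim0
  induction r generalizing s G with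
  | zero => simp [hzero, hmono, wickSum_nil]
  | succ r ih =>
    rw [List.ofFn_succ, wickSum_cons, Finset.sum_range_succ']
    simp only [sum_strictMono_succ, Finset.sum_add_distrib, detTerm_succ]
    rw [add_right_comm]
    congr 1
    -- Together with the term `ρ = 0`, these are the sums for `r` factors, except for `ρ = r + 1`,
    -- where there are no strictly increasing maps into `Fin r`.
    · rw [ih, Finset.sum_range_succ', Finset.sum_range_succ _ r,
        sum_strictMono_of_lt (Nat.lt_succ_self r), add_zero]
      simp [hzero, hmono]
    · cases s with
      | zero =>
        rw [List.ofFn_zero, contract_nil, smul_zero]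
        symm
        refine Finset.sum_eq_zero fun ρ _ => Finset.sum_eq_zero fun i _ => ?_
        exact sum_strictMono_of_lt (Nat.succ_pos ρ) _
      | succ s =>
        rw [contract_ofFn, List.length_ofFn]
        simp only [ih, sum_detTerm_cons]
        simp only [Finset.smul_sum]
        rw [Finset.sum_comm]
        refine Finset.sum_congr rfl fun ρ _ => ?_
        rw [Finset.sum_comm]

end DetSum

/-! ### Series in disjoint sets of variables -/

section Coordinates

variable {r s : ℕ}

/-- The exponent of a variable in a monomial. -/
def coord (e : Expo r s) (v : Fin r ⊕ Fin s) : ℚ :=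
  Sum.elim (fun i => OrderDual.ofDual (e.1 i)) e.2 v

theorem coord_ext {e e' : Expo r s} (h : ∀ v, coord e v = coord e' v) : e = e' :=
  Prod.ext (funext fun i => h (Sum.inl i)) (funext fun j => h (Sum.inr j))

theorem coord_add (e e' : Expo r s) (v : Fin r ⊕ Fin s) :
    coord (e + e') v = coord e v + coord e' v := by
  cases v <;> rfl

theorem coord_sub (e e' : Expo r s) (v : Fin r ⊕ Fin s) :
    coord (e - e') v = coord e v - coord e' v := by
  cases v <;> rfl

theorem coord_zero (v : Fin r ⊕ Fin s) : coord (0 : Expo r s) v = 0 := by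
  cases v <;> rfl

theorem coord_sum {κ : Type*} (S : Finset κ) (e : κ → Expo r s) (v : Fin r ⊕ Fin s) :
    coord (∑ k ∈ S, e k) v = ∑ k ∈ S, coord (e k) v :=
  map_sum (⟨⟨fun e => coord e v, coord_zero v⟩, fun e e' => coord_add e e' v⟩ : Expo r s →+ ℚ) e S

theorem coord_expo (v w : Fin r ⊕ Fin s) (p : ℚ) :
    coord (expo v p) w = if v = w then p else 0 := by
  rcases v with i | j <;> rcases w with i' | j'
  · by_cases h : i = i'
    · subst h
      simp [coord, expo]
    · simp [coord, expo, h]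
  · simp [coord, expo]
  · simp [coord, expo]
  · by_cases h : j = j'
    · subst h
      simp [coord, expo]
    · simp [coord, expo, h]

open Classical in
/-- The part of a monomial in the variables in `V`. -/
def restrict (V : Set (Fin r ⊕ Fin s)) (e : Expo r s) : Expo r s :=
  (fun i => if Sum.inl i ∈ V then e.1 i else 0, fun j => if Sum.inr j ∈ V then e.2 j else 0)

open Classical in
theorem coord_restrict (V : Set (Fin r ⊕ Fin s)) (e : Expo r s) (v : Fin r ⊕ Fin s) :
    coord (restrict V e) v = if v ∈ V then coord e v else 0 := by
  rcases v with i | j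
  · by_cases h : Sum.inl i ∈ V <;> simp [coord, restrict, h]
  · by_cases h : Sum.inr j ∈ V <;> simp [coord, restrict, h]

theorem coord_restrict_of_mem {V : Set (Fin r ⊕ Fin s)} (e : Expo r s) {v : Fin r ⊕ Fin s}
    (h : v ∈ V) : coord (restrict V e) v = coord e v := by
  classical
  rw [coord_restrict, if_pos h]

theorem coord_restrict_of_notMem {V : Set (Fin r ⊕ Fin s)} (e : Expo r s) {v : Fin r ⊕ Fin s}
    (h : v ∉ V) : coord (restrict V e) v = 0 := by
  classical
  rw [coord_restrict, if_neg h]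

theorem restrict_restrict {V W : Set (Fin r ⊕ Fin s)} (h : V ⊆ W) (e : Expo r s) :
    restrict V (restrict W e) = restrict V e := by
  refine coord_ext fun v => ?_
  by_cases hv : v ∈ V
  · rw [coord_restrict_of_mem _ hv, coord_restrict_of_mem _ hv, coord_restrict_of_mem _ (h hv)]
  · rw [coord_restrict_of_notMem _ hv, coord_restrict_of_notMem _ hv]

/-- The coefficients of `f` vanish at the monomials that are not monomials in the variables in `V`. -/
def IsSeriesIn {A : Type*} [Zero A] (V : Set (Fin r ⊕ Fin s)) (f : Expo r s → A) : Prop :=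
  ∀ e, f e ≠ 0 → ∀ v ∉ V, coord e v = 0

/-- A monomial splits in at most one way into a part in `V` and a part in `W`. This gives the
existence of the products and reduces each of their coefficients to a single term. -/
theorem eq_restrict_of_add {V W : Set (Fin r ⊕ Fin s)} (hVW : Disjoint V W) {e p q : Expo r s}
    (h : p + q = e) (hp : ∀ v ∉ V, coord p v = 0) (hq : ∀ v ∉ W, coord q v = 0) :
    p = restrict V e ∧ q = restrict W e := by
  subst h
  constructor
  · refine coord_ext fun v => ?_
    by_cases hv : v ∈ V
    · rw [coord_restrict_of_mem _ hv, coord_add, hq v (Set.disjoint_left.1 hVW hv), add_zero]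
    · rw [coord_restrict_of_notMem _ hv, hp v hv]
  · refine coord_ext fun v => ?_
    by_cases hv : v ∈ W
    · rw [coord_restrict_of_mem _ hv, coord_add, hp v (Set.disjoint_right.1 hVW hv), zero_add]
    · rw [coord_restrict_of_notMem _ hv, hq v hv]

section Conv

variable {A E : Type*} [Zero A] [AddCommMonoid E] {V : Set (Fin r ⊕ Fin s)}
  {f : Expo r s → A} {F : Expo r s → E}

theorem eq_restrict_of_ne_zero (hf : IsSeriesIn V f) (hF : IsSeriesIn Vᶜ F) {e p : Expo r s}
    (hp : f p ≠ 0) (hq : F (e - p) ≠ 0) : p = restrict V e ∧ e - p = restrict Vᶜ e :=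
  eq_restrict_of_add disjoint_compl_right (add_sub_cancel p e) (hf p hp) (hF _ hq)

theorem convExists_of_isSeriesIn (hf : IsSeriesIn V f) (hF : IsSeriesIn Vᶜ F) :
    ConvExists f F := fun e =>
  (Set.finite_singleton (restrict V e)).subset fun _ hp => (eq_restrict_of_ne_zero hf hF hp.1 hp.2).1

theorem conv_eq_of_isSeriesIn [SMulWithZero A E] (hf : IsSeriesIn V f) (hF : IsSeriesIn Vᶜ F) (e : Expo r s) :
    conv f F e = f (restrict V e) • F (restrict Vᶜ e) := by
  have he : e - restrict V e = restrict Vᶜ e := by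
    refine coord_ext fun v => ?_
    rw [coord_sub]
    by_cases hv : v ∈ V
    · rw [coord_restrict_of_mem _ hv, coord_restrict_of_notMem _ (Set.notMem_compl_iff.2 hv), sub_self]
    · rw [coord_restrict_of_notMem _ hv, coord_restrict_of_mem _ (Set.mem_compl hv), sub_zero]
  rw [conv, finsum_eq_single _ (restrict V e), he]
  intro p hp
  by_contra hne
  refine hp (eq_restrict_of_ne_zero hf hF (e := e) ?_ ?_).1
  · intro h0
    exact hne (by rw [h0, zero_smul])
  · intro h0
    exact hne (by rw [h0, smul_zero])

end Conv

theorem isSeriesIn_mul {V W : Set (Fin r ⊕ Fin s)} {X Y : HahnSeries (Expo r s) ℂ}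
    (hX : IsSeriesIn V X.coeff) (hY : IsSeriesIn W Y.coeff) : IsSeriesIn (V ∪ W) (X * Y).coeff := by
  intro e he v hv
  rw [HahnSeries.coeff_mul] at he
  obtain ⟨⟨p, q⟩, hpq, hne⟩ := Finset.exists_ne_zero_of_sum_ne_zero he
  rw [Finset.mem_antidiagonal] at hpq
  obtain ⟨hp, hq, rfl⟩ := hpq
  rw [coord_add, hX p hp v fun h => hv (Or.inl h), hY q hq v fun h => hv (Or.inr h), add_zero]

theorem coeff_mul_of_isSeriesIn {V W : Set (Fin r ⊕ Fin s)} (hVW : Disjoint V W)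
    {X Y : HahnSeries (Expo r s) ℂ} (hX : IsSeriesIn V X.coeff) (hY : IsSeriesIn W Y.coeff)
    {e : Expo r s} (he : ∀ v ∉ V ∪ W, coord e v = 0) :
    (X * Y).coeff e = X.coeff (restrict V e) * Y.coeff (restrict W e) := by
  have hadd : restrict V e + restrict W e = e := by
    refine coord_ext fun v => ?_
    rw [coord_add]
    by_cases hv : v ∈ V
    · rw [coord_restrict_of_mem _ hv, coord_restrict_of_notMem _ (Set.disjoint_left.1 hVW hv),
        add_zero]
    · rw [coord_restrict_of_notMem _ hv, zero_add]
      by_cases hw : v ∈ W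
      · rw [coord_restrict_of_mem _ hw]
      · rw [coord_restrict_of_notMem _ hw, he v fun h => h.elim hv hw]
  rw [HahnSeries.coeff_mul, Finset.sum_eq_single (restrict V e, restrict W e)]
  · rintro ⟨p, q⟩ hpq hne
    rw [Finset.mem_antidiagonal] at hpq
    obtain ⟨hp, hq, hpe⟩ := hpq
    obtain ⟨rfl, rfl⟩ := eq_restrict_of_add hVW hpe (hX p hp) (hY q hq)
    exact absurd rfl hne
  · intro hnot
    rw [Finset.mem_antidiagonal] at hnot
    by_contra hne
    exact hnot ⟨left_ne_zero_of_mul hne, right_ne_zero_of_mul hne, hadd⟩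

/-- Induction on `S`; the union of the sets already treated is disjoint from the next one, so
`coeff_mul_of_isSeriesIn` applies. -/
theorem coeff_prod_of_isSeriesIn {κ : Type*} (S : Finset κ) (V : κ → Set (Fin r ⊕ Fin s))
    (X : κ → HahnSeries (Expo r s) ℂ) (hX : ∀ k ∈ S, IsSeriesIn (V k) (X k).coeff)
    (hV : (S : Set κ).PairwiseDisjoint V) :
    IsSeriesIn (⋃ k ∈ S, V k) (∏ k ∈ S, X k).coeff ∧
      ∀ e : Expo r s, (∀ v ∉ ⋃ k ∈ S, V k, coord e v = 0) →
        (∏ k ∈ S, X k).coeff e = ∏ k ∈ S, (X k).coeff (restrict (V k) e) := by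
  classical
  induction S using Finset.induction_on with
  | empty =>
    have h : ∀ e : Expo r s, (1 : HahnSeries (Expo r s) ℂ).coeff e = if e = 0 then 1 else 0 :=
      fun e => HahnSeries.coeff_one.trans (by congr)
    constructor
    · intro e he v _
      rw [Finset.prod_empty, h] at he
      rw [show e = 0 from by_contra fun h0 => he (if_neg h0), coord_zero]
    · intro e he
      rw [Finset.prod_empty, Finset.prod_empty, h, if_pos]
      exact coord_ext fun v => by rw [he v (by simp), coord_zero]
  | insert a S ha ih =>
    obtain ⟨h1, h2⟩ := ih (fun k hk => hX k (Finset.mem_insert_of_mem hk))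
      (hV.subset (by simp))
    have hdisj : Disjoint (V a) (⋃ k ∈ S, V k) := by
      simp only [Set.disjoint_iUnion_right]
      intro k hk
      exact hV (by simp) (by simp [hk]) (by rintro rfl; exact ha hk)
    have hun : (⋃ k ∈ insert a S, V k) = V a ∪ ⋃ k ∈ S, V k := Finset.set_biUnion_insert a S V
    have hXa := hX a (Finset.mem_insert_self a S)
    rw [hun, Finset.prod_insert ha]
    refine ⟨isSeriesIn_mul hXa h1, fun e he => ?_⟩
    rw [coeff_mul_of_isSeriesIn hdisj hXa h1 he, h2 _ fun v hv => coord_restrict_of_notMem _ hv,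
      Finset.prod_insert ha]
    congr 1
    refine Finset.prod_congr rfl fun k hk => ?_
    have hk' : V k ⊆ ⋃ k ∈ S, V k := fun v hv => Set.mem_iUnion₂.2 ⟨k, hk, hv⟩
    rw [restrict_restrict hk']

end Coordinates

/-! ### The coefficients of the contractions -/

section Expansion

variable {r s : ℕ} (i : Fin r) (j : Fin s)

/-- The exponent of `x_i ^ α * y_j ^ β`. -/
def pairExpo (α β : ℚ) : Expo r s := expo (Sum.inl i) α + expo (Sum.inr j) β

theorem coord_pairExpo_inl (α β : ℚ) : coord (pairExpo i j α β) (Sum.inl i) = α := by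
  simp [pairExpo, coord_add, coord_expo]

theorem coord_pairExpo_inr (α β : ℚ) : coord (pairExpo i j α β) (Sum.inr j) = β := by
  simp [pairExpo, coord_add, coord_expo]

theorem restrict_pair (e : Expo r s) : restrict {Sum.inl i, Sum.inr j} e =
    pairExpo i j (coord e (Sum.inl i)) (coord e (Sum.inr j)) := by
  classical
  refine coord_ext fun v => ?_
  rw [coord_restrict, pairExpo, coord_add, coord_expo, coord_expo]
  rcases v with i' | j'
  · by_cases h : i = i'
    · subst h; simp
    · simp [h, Ne.symm h]
  · by_cases h : j = j'
    · subst h; simp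
    · simp [h, Ne.symm h]

theorem expansionExpo_eq (p q : ℚ) (k : ℕ) :
    expansionExpo i j p q k = pairExpo i j (p - k) (q + k) := by
  change (Pi.single i (OrderDual.toDual (p - (k : ℚ))), Pi.single j (q + (k : ℚ))) =
    pairExpo i j (p - k) (q + k)
  rw [pairExpo, expo, expo]
  exact Prod.ext (add_zero _).symm (zero_add _).symm

theorem iota_single (p q : ℚ) (t : ℤ) (z : ℂ) : iota i j (Finsupp.single (p, q, t) z) =
    z • HahnSeries.embDomain (expansionExpo i j (p + (t : ℚ)) q)
      (HahnSeries.toPowerSeries.symm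
        (PowerSeries.mk fun k => ((Ring.choose t k : ℤ) : ℂ) * (-1) ^ k)) :=
  Finsupp.linearCombination_single ℂ z _

theorem coeff_iota_single {p q : ℚ} {t : ℤ} {z : ℂ} (k : ℕ) {α β : ℚ} (hα : α = p + t - k)
    (hβ : β = q + k) : (iota i j (Finsupp.single (p, q, t) z)).coeff (pairExpo i j α β) =
      z * (((Ring.choose t k : ℤ) : ℂ) * (-1) ^ k) := by
  rw [iota_single, HahnSeries.coeff_smul, hα, hβ, ← expansionExpo_eq, HahnSeries.embDomain_coeff,
    HahnSeries.coeff_toPowerSeries_symm, PowerSeries.coeff_mk, smul_eq_mul]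

theorem coeff_iota_single_ne_zero {p q : ℚ} {t : ℤ} {z : ℂ} {e : Expo r s}
    (h : (iota i j (Finsupp.single (p, q, t) z)).coeff e ≠ 0) :
    ∃ k : ℕ, e = pairExpo i j (p + t - k) (q + k) := by
  by_contra hne
  push Not at hne
  refine h ?_
  rw [iota_single, HahnSeries.coeff_smul, HahnSeries.embDomain_of_notMem_range, smul_zero]
  rintro ⟨k, hk⟩
  exact hne k (by rw [← hk, expansionExpo_eq])

theorem coeff_iota_single_eq_zero {p q : ℚ} {t : ℤ} {z : ℂ} {α β : ℚ}
    (h : ∀ k : ℕ, α = p + t - k → β = q + k → False) :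
    (iota i j (Finsupp.single (p, q, t) z)).coeff (pairExpo i j α β) = 0 := by
  by_contra hne
  obtain ⟨k, hk⟩ := coeff_iota_single_ne_zero i j hne
  refine h k ?_ ?_
  · rw [← coord_pairExpo_inl i j α β, hk, coord_pairExpo_inl]
  · rw [← coord_pairExpo_inr i j α β, hk, coord_pairExpo_inr]

theorem isSeriesIn_iota (f : AlgFun) :
    IsSeriesIn {Sum.inl i, Sum.inr j} (iota i j f : HahnSeries (Expo r s) ℂ).coeff := by
  induction f using Finsupp.induction_linear with
  | zero => intro e he; simp at he
  | add f f' hf hf' =>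
    intro e he v hv
    rw [map_add, HahnSeries.coeff_add] at he
    by_cases h : (iota i j f).coeff e = 0
    · exact hf' e (fun h' => he (by rw [h, h', add_zero])) v hv
    · exact hf e h v hv
  | single w z =>
    obtain ⟨p, q, t⟩ := w
    intro e he v hv
    obtain ⟨k, rfl⟩ := coeff_iota_single_ne_zero i j he
    simp only [Set.mem_insert_iff, Set.mem_singleton_iff, not_or] at hv
    rw [pairExpo, coord_add, coord_expo, coord_expo, if_neg (Ne.symm hv.1), if_neg (Ne.symm hv.2),
      add_zero]

/-! ### Binomial identities and the derivatives of expansions -/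

theorem succ_mul_choose_succ {R : Type*} [CommRing R] [BinomialRing R] (x : R) (k : ℕ) :
    ((k : R) + 1) * Ring.choose x (k + 1) = (x - k) * Ring.choose x k := by
  have h := Ring.choose_smul_choose x (Nat.le_succ k)
  rw [Nat.choose_succ_self_right, Nat.succ_eq_add_one, Nat.add_sub_cancel_left, Ring.choose_one_right,
    nsmul_eq_mul] at h
  push_cast at h
  rw [h, mul_comm]

theorem succ_mul_choose_succ' {R : Type*} [CommRing R] [BinomialRing R] (x : R) (k : ℕ) :
    ((k : R) + 1) * Ring.choose x (k + 1) = x * Ring.choose (x - 1) k := by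
  have h := Ring.choose_add_smul_choose (x - 1) k 1
  rw [Nat.choose_one_right, Nat.cast_one, sub_add_cancel, Ring.choose_one_right, nsmul_eq_mul] at h
  push_cast at h
  exact h

theorem derivX_single (p q : ℚ) (t : ℤ) (z : ℂ) : derivX (Finsupp.single (p, q, t) z) =
    Finsupp.single (p - 1, q, t) (z * p) + Finsupp.single (p, q, t - 1) (z * t) := by
  rw [derivX, Finsupp.linearCombination_single, smul_add, Finsupp.smul_single, Finsupp.smul_single,
    smul_eq_mul, smul_eq_mul]

theorem derivY_single (p q : ℚ) (t : ℤ) (z : ℂ) : derivY (Finsupp.single (p, q, t) z) =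
    Finsupp.single (p, q - 1, t) (z * q) - Finsupp.single (p, q, t - 1) (z * t) := by
  rw [derivY, Finsupp.linearCombination_single, smul_sub, Finsupp.smul_single, Finsupp.smul_single,
    smul_eq_mul, smul_eq_mul]

/-- Expansion commutes with differentiation: $\partial_x$ multiplies the coefficient of
$x^{\alpha+1}$ by $\alpha+1$. This allows the coefficients of all $G_{mn}$ to be read off from those
of $g$. -/
theorem coeff_iota_derivX (f : AlgFun) (α β : ℚ) :
    (iota i j (derivX f)).coeff (pairExpo i j α β) =
      ((α + 1 : ℚ) : ℂ) * (iota i j f).coeff (pairExpo i j (α + 1) β) := by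
  induction f using Finsupp.induction_linear with
  | zero => simp
  | add f f' hf hf' => simp only [map_add, HahnSeries.coeff_add, hf, hf', mul_add]
  | single w z =>
    obtain ⟨p, q, t⟩ := w
    rw [derivX_single, map_add, HahnSeries.coeff_add]
    by_cases h : ∃ k : ℕ, α = p + t - 1 - k ∧ β = q + k
    · obtain ⟨k, hα, hβ⟩ := h
      rw [coeff_iota_single i j k (by rw [hα]; ring) hβ,
        coeff_iota_single i j k (by rw [hα]; push_cast; ring) hβ,
        coeff_iota_single i j k (by rw [hα]; ring) hβ, hα]
      -- For a basis term the claim is $p\binom tk+t\binom{t-1}k=(p+t-k)\binom tk$.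
      have h1 := (succ_mul_choose_succ t k).symm.trans (succ_mul_choose_succ' t k)
      have h2 : ((t : ℂ) - k) * (Ring.choose t k : ℤ) = t * (Ring.choose (t - 1) k : ℤ) := by
        exact_mod_cast h1
      push_cast
      linear_combination (-z * (-1) ^ k) * h2
    · have h' : ∀ k : ℕ, α = p + t - 1 - k → β = q + k → False := fun k h1 h2 => h ⟨k, h1, h2⟩
      rw [coeff_iota_single_eq_zero i j fun k h1 h2 => h' k (by rw [h1]; ring) h2,
        coeff_iota_single_eq_zero i j fun k h1 h2 => h' k (by rw [h1]; push_cast; ring) h2,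
        coeff_iota_single_eq_zero i j fun k h1 h2 => h' k (by linear_combination h1) h2]
      ring

theorem coeff_iota_derivY (f : AlgFun) (α β : ℚ) :
    (iota i j (derivY f)).coeff (pairExpo i j α β) =
      ((β + 1 : ℚ) : ℂ) * (iota i j f).coeff (pairExpo i j α (β + 1)) := by
  induction f using Finsupp.induction_linear with
  | zero => simp
  | add f f' hf hf' => simp only [map_add, HahnSeries.coeff_add, hf, hf', mul_add]
  | single w z =>
    obtain ⟨p, q, t⟩ := w
    rw [derivY_single, map_sub, HahnSeries.coeff_sub]
    by_cases h : ∃ k : ℕ, α = p + t - k ∧ β = q - 1 + k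
    · obtain ⟨k, hα, hβ⟩ := h
      rw [coeff_iota_single i j k hα hβ,
        coeff_iota_single (β := β + 1) i j k hα (by rw [hβ]; ring)]
      -- Lowering `t` leaves the exponent `q` of $y$ in place, so the second term of the derivative
      -- contributes its coefficient of index `k - 1`, and nothing for `k = 0`.
      cases k with
      | zero =>
        rw [coeff_iota_single_eq_zero i j, hβ]
        · push_cast
          ring
        · intro k h1 h2
          have h3 : ((k + 1 : ℕ) : ℚ) = 0 := by
            push_cast at hβ ⊢
            linear_combination hβ - h2
          exact Nat.succ_ne_zero k (by exact_mod_cast h3)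
      | succ k =>
        rw [coeff_iota_single i j k (by rw [hα]; push_cast; ring) (by rw [hβ]; push_cast; ring), hβ]
        have h2 : ((k : ℂ) + 1) * (Ring.choose t (k + 1) : ℤ) = t * (Ring.choose (t - 1) k : ℤ) := by
          exact_mod_cast succ_mul_choose_succ' t k
        push_cast
        linear_combination (z * (-1) ^ k) * h2
    · have h' : ∀ k : ℕ, α = p + t - k → β = q - 1 + k → False := fun k h1 h2 => h ⟨k, h1, h2⟩
      rw [coeff_iota_single_eq_zero i j h',
        coeff_iota_single_eq_zero i j fun k h1 h2 => h' (k + 1) (by rw [h1]; push_cast; ring)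
          (by rw [h2]; push_cast; ring),
        coeff_iota_single_eq_zero i j fun k h1 h2 => h' k h1 (by linear_combination h2)]
      ring

theorem coeff_iota_derivX_pow (m : ℕ) (f : AlgFun) (α β : ℚ) :
    (iota i j ((derivX ^ m) f)).coeff (pairExpo i j α β) =
      (m.factorial : ℂ) * ((Ring.choose (α + m) m : ℚ) : ℂ) *
        (iota i j f).coeff (pairExpo i j (α + m) β) := by
  induction m generalizing f with
  | zero => simp
  | succ m ih =>
    have h : ((m : ℂ) + 1) * ((Ring.choose (α + m + 1) (m + 1) : ℚ) : ℂ) =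
        ((α + m + 1 : ℚ) : ℂ) * ((Ring.choose (α + m) m : ℚ) : ℂ) := by
      have := succ_mul_choose_succ' (α + m + 1) m
      rw [add_sub_cancel_right] at this
      exact_mod_cast this
    rw [pow_succ, Module.End.mul_apply, ih, coeff_iota_derivX, Nat.factorial_succ]
    push_cast at h ⊢
    rw [← add_assoc]
    linear_combination (-(m.factorial : ℂ) * (iota i j f).coeff (pairExpo i j (α + m + 1) β)) * h

theorem coeff_iota_derivY_pow (n : ℕ) (f : AlgFun) (α β : ℚ) :
    (iota i j ((derivY ^ n) f)).coeff (pairExpo i j α β) =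
      (n.factorial : ℂ) * ((Ring.choose (β + n) n : ℚ) : ℂ) *
        (iota i j f).coeff (pairExpo i j α (β + n)) := by
  induction n generalizing f with
  | zero => simp
  | succ m ih =>
    have h : ((m : ℂ) + 1) * ((Ring.choose (β + m + 1) (m + 1) : ℚ) : ℂ) =
        ((β + m + 1 : ℚ) : ℂ) * ((Ring.choose (β + m) m : ℚ) : ℂ) := by
      have := succ_mul_choose_succ' (β + m + 1) m
      rw [add_sub_cancel_right] at this
      exact_mod_cast this
    rw [pow_succ, Module.End.mul_apply, ih, coeff_iota_derivY, Nat.factorial_succ]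
    push_cast at h ⊢
    rw [← add_assoc]
    linear_combination (-(m.factorial : ℂ) * (iota i j f).coeff (pairExpo i j α (β + m + 1))) * h

theorem coeff_G (m n : ℕ) (α β : ℚ) : (G m n i j).coeff (pairExpo i j α β) =
    ((Ring.choose (α + m) m : ℚ) : ℂ) * ((Ring.choose (β + n) n : ℚ) : ℂ) *
      (iota i j g).coeff (pairExpo i j (α + m) (β + n)) := by
  rw [G, gDeriv, map_smul, HahnSeries.coeff_smul, coeff_iota_derivX_pow, coeff_iota_derivY_pow,
    smul_eq_mul]
  have hm : (m.factorial : ℂ) ≠ 0 := by exact_mod_cast m.factorial_ne_zero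
  have hn : (n.factorial : ℂ) ≠ 0 := by exact_mod_cast n.factorial_ne_zero
  field_simp

theorem choose_neg_one_mul (k : ℕ) : ((Ring.choose (-1 : ℤ) k : ℤ) : ℂ) * (-1) ^ k = 1 := by
  rw [Ring.choose_neg', Ring.multichoose_one]
  rcases Nat.even_or_odd k with h | h
  · rw [Int.negOnePow_even _ (by exact_mod_cast h), h.neg_one_pow]
    simp
  · rw [Int.negOnePow_odd _ (by exact_mod_cast h), h.neg_one_pow]
    simp

/-- The two summands of `g` expand to $\frac12\sum_{\kappa\ge0}x^{-1/2-\kappa}y^{-1/2+\kappa}$ and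
$\frac12\sum_{\kappa\ge0}x^{-3/2-\kappa}y^{1/2+\kappa}$. They hit $k=\kappa$ and $k=\kappa+1$, with
$l=-k$: the halves add up to $1$ for $k>0$, and only the first reaches $k=0$. This explains the
factor $\frac12$ in the ordering of zero modes. -/
theorem coeff_iota_g (k l : ℤ) :
    (iota i j g).coeff (pairExpo i j (-(k : ℚ) - 1 / 2) (-(l : ℚ) - 1 / 2)) = pairCoeff k l := by
  rw [g, map_add, HahnSeries.coeff_add, pairCoeff]
  have hzero : ∀ (p q : ℚ) (z : ℂ), (∀ κ : ℕ, -(k : ℚ) - 1 / 2 = p + ((-1 : ℤ) : ℚ) - κ →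
      -(l : ℚ) - 1 / 2 = q + κ → False) → (iota i j (Finsupp.single (p, q, -1) z)).coeff
        (pairExpo i j (-(k : ℚ) - 1 / 2) (-(l : ℚ) - 1 / 2)) = 0 :=
    fun p q z h => coeff_iota_single_eq_zero i j h
  have hone : ∀ (p q : ℚ) (κ : ℕ), -(k : ℚ) - 1 / 2 = p + ((-1 : ℤ) : ℚ) - κ →
      -(l : ℚ) - 1 / 2 = q + κ → (iota i j (Finsupp.single (p, q, -1) (1 / 2))).coeff
        (pairExpo i j (-(k : ℚ) - 1 / 2) (-(l : ℚ) - 1 / 2)) = 1 / 2 := by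
    intro p q κ h1 h2
    rw [coeff_iota_single i j κ h1 h2, choose_neg_one_mul, mul_one]
  by_cases hkl : k + l = 0
  · obtain rfl : l = -k := by omega
    rw [if_pos hkl]
    rcases lt_trichotomy k 0 with hk | rfl | hk
    · rw [hzero, hzero, if_neg hk.ne, if_neg hk.not_gt, add_zero]
      · intro κ h1 _
        have : (k : ℚ) = ((κ : ℤ) + 1 : ℤ) := by push_cast at h1 ⊢; linear_combination -h1
        have := Int.cast_injective this
        omega
      · intro κ h1 _
        have : (k : ℚ) = ((κ : ℤ) : ℤ) := by push_cast at h1 ⊢; linear_combination -h1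
        have := Int.cast_injective this
        omega
    · rw [hone _ _ 0 (by norm_num) (by norm_num), hzero, if_pos rfl, add_zero]
      intro κ h1 _
      have : ((0 : ℤ) : ℚ) = ((κ : ℤ) + 1 : ℤ) := by push_cast at h1 ⊢; linear_combination -h1
      have := Int.cast_injective this
      omega
    · obtain ⟨κ, rfl⟩ : ∃ κ : ℕ, k = κ + 1 := ⟨(k - 1).toNat, by omega⟩
      rw [hone _ _ (κ + 1) (by push_cast; ring) (by push_cast; ring),
        hone _ _ κ (by push_cast; ring) (by push_cast; ring), if_neg hk.ne', if_pos hk]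
      norm_num
  · rw [if_neg hkl, hzero, hzero, add_zero]
    · intro κ h1 h2
      refine hkl ?_
      have : ((k + l : ℤ) : ℚ) = ((0 : ℤ) : ℚ) := by push_cast at h1 ⊢; linear_combination -h1 - h2
      exact Int.cast_injective this
    · intro κ h1 h2
      refine hkl ?_
      have : ((k + l : ℤ) : ℚ) = ((0 : ℤ) : ℚ) := by push_cast at h1 ⊢; linear_combination -h1 - h2
      exact Int.cast_injective this

theorem exists_int_of_coeff_iota_g_ne_zero {α β : ℚ}
    (h : (iota i j g).coeff (pairExpo i j α β) ≠ 0) :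
    (∃ k : ℤ, α = -(k : ℚ) - 1 / 2) ∧ ∃ l : ℤ, β = -(l : ℚ) - 1 / 2 := by
  rw [g, map_add, HahnSeries.coeff_add] at h
  have key : ∃ k : ℕ, (α = -1 / 2 - k ∧ β = -1 / 2 + k) ∨ (α = -3 / 2 - k ∧ β = 1 / 2 + k) := by
    by_contra hne
    push Not at hne
    refine h ?_
    rw [coeff_iota_single_eq_zero i j, coeff_iota_single_eq_zero i j, add_zero]
    · intro k h1 h2
      exact (hne k).2 (by rw [h1]; push_cast; ring) h2
    · intro k h1 h2
      exact (hne k).1 (by rw [h1]; push_cast; ring) h2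
  obtain ⟨k, ⟨rfl, rfl⟩ | ⟨rfl, rfl⟩⟩ := key
  · exact ⟨⟨k, by push_cast; ring⟩, ⟨-k, by push_cast; ring⟩⟩
  · exact ⟨⟨k + 1, by push_cast; ring⟩, ⟨-k - 1, by push_cast; ring⟩⟩

theorem coeff_G_of_int (m n : ℕ) (k l : ℤ) {α β : ℚ} (hα : α = -(k : ℚ) - 1 / 2 - m)
    (hβ : β = -(l : ℚ) - 1 / 2 - n) : (G m n i j).coeff (pairExpo i j α β) =
      ((Ring.choose (-(k : ℚ) - 1 / 2) m : ℚ) : ℂ) * ((Ring.choose (-(l : ℚ) - 1 / 2) n : ℚ) : ℂ) *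
        pairCoeff k l := by
  rw [coeff_G, hα, hβ, sub_add_cancel, sub_add_cancel, coeff_iota_g]

theorem exists_int_of_coeff_G_ne_zero {m n : ℕ} {α β : ℚ}
    (h : (G m n i j).coeff (pairExpo i j α β) ≠ 0) :
    (∃ k : ℤ, α = -(k : ℚ) - 1 / 2 - m) ∧ ∃ l : ℤ, β = -(l : ℚ) - 1 / 2 - n := by
  rw [coeff_G] at h
  obtain ⟨⟨k, hk⟩, ⟨l, hl⟩⟩ := exists_int_of_coeff_iota_g_ne_zero i j (right_ne_zero_of_mul h)
  exact ⟨⟨k, by linear_combination hk⟩, ⟨l, by linear_combination hl⟩⟩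

end Expansion

/-! ### Coefficients of normal-ordered products -/

section NordSeries

variable {H : Type*} {r s : ℕ}

theorem coord_totalExpo (l : List (Factor H r s)) (n : Fin l.length → ℤ) (v : Fin r ⊕ Fin s) :
    coord (Factor.totalExpo l n) v = ∑ k, if (l.get k).var = v then
      -(n k : ℚ) - 1 / 2 - ((l.get k).order : ℚ) else 0 := by
  rw [Factor.totalExpo, coord_sum]
  exact Finset.sum_congr rfl fun k _ => coord_expo _ _ _

theorem coord_totalExpo_var {l : List (Factor H r s)} (hl : (l.map Factor.var).Nodup)
    (n : Fin l.length → ℤ) (k : Fin l.length) :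
    coord (Factor.totalExpo l n) (l.get k).var = -(n k : ℚ) - 1 / 2 - ((l.get k).order : ℚ) := by
  rw [coord_totalExpo, Finset.sum_eq_single k, if_pos rfl]
  · intro k' _ hk'
    refine if_neg fun h => hk' ?_
    have hinj := List.inj_on_of_nodup_map hl (List.get_mem l k') (List.get_mem l k) h
    exact (List.nodup_iff_injective_get.1 hl.of_map) hinj
  · simp

theorem coord_totalExpo_of_notMem {l : List (Factor H r s)} (n : Fin l.length → ℤ)
    {v : Fin r ⊕ Fin s} (hv : v ∉ l.map Factor.var) : coord (Factor.totalExpo l n) v = 0 := by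
  rw [coord_totalExpo]
  refine Finset.sum_eq_zero fun k _ => if_neg fun h => hv ?_
  exact List.mem_map.2 ⟨_, List.get_mem l k, h⟩

section Factors

/-- The variables `x_i` with `i ∈ I` and `y_j` with `j ∈ J`. -/
def varSet (I : Finset (Fin r)) (J : Finset (Fin s)) : Set (Fin r ⊕ Fin s) :=
  {v | Sum.elim (· ∈ I) (· ∈ J) v}

variable (a : Fin r → H) (b : Fin s → H) (m : Fin r → ℕ) (n : Fin s → ℕ)
  (I : Finset (Fin r)) (J : Finset (Fin s))

theorem mem_map_var_factors (v : Fin r ⊕ Fin s) :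
    v ∈ (xFactors s a m I ++ yFactors r b n J).map Factor.var ↔ v ∉ varSet I J := by
  rw [List.map_append, xFactors, yFactors, List.map_map, List.map_map]
  rcases v with i | j <;> simp [varSet]

theorem nodup_map_var_factors :
    ((xFactors s a m I ++ yFactors r b n J).map Factor.var).Nodup := by
  rw [List.map_append, xFactors, yFactors, List.map_map, List.map_map, List.nodup_append]
  refine ⟨((List.nodup_finRange r).filter _).map Sum.inl_injective,
    ((List.nodup_finRange s).filter _).map Sum.inr_injective, ?_⟩
  intro x hx y hy
  obtain ⟨i, _, rfl⟩ := List.mem_map.1 hx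
  obtain ⟨j, _, rfl⟩ := List.mem_map.1 hy
  simp

theorem yFactors_univ : yFactors r b n Finset.univ = [] := by simp [yFactors]

theorem xFactors_univ : xFactors s a m Finset.univ = [] := by simp [xFactors]

end Factors

variable [AddCommGroup H] [Module ℂ H] (B : LinearMap.BilinForm ℂ H)
  (U : Type*) [AddCommGroup U] [Module ℂ U] [Module (TensorAlgebra ℂ H) U]

theorem exists_totalExpo_of_nordSeries_ne_zero {l : List (Factor H r s)} {e : Expo r s}
    (h : nordSeries B U l e ≠ 0) : ∃ n, Factor.totalExpo l n = e := by
  classical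
  by_contra hne
  push Not at hne
  refine h ?_
  rw [nordSeries]
  simp [hne]

/-- As the variables are distinct, the exponents determine the modes. The modes `N` are indexed by
variables and not by positions, so that one `N` serves every selection of factors. -/
theorem nordSeries_eq_smul_nord {l : List (Factor H r s)} (hl : (l.map Factor.var).Nodup)
    {e : Expo r s} (N : Fin r ⊕ Fin s → ℤ)
    (he : ∀ f ∈ l, coord e f.var = -(N f.var : ℚ) - 1 / 2 - (f.order : ℚ))
    (he' : ∀ v ∉ l.map Factor.var, coord e v = 0) :
    nordSeries B U l e =
      (l.map fun f => ((Ring.choose (-(N f.var : ℚ) - 1 / 2) f.order : ℚ) : ℂ)).prod •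
        nord B U (l.map fun f => (f.vec, N f.var)) := by
  have hN : Factor.totalExpo l (fun k => N (l.get k).var) = e := by
    refine coord_ext fun v => ?_
    by_cases hv : v ∈ l.map Factor.var
    · obtain ⟨f, hf, rfl⟩ := List.mem_map.1 hv
      obtain ⟨k, rfl⟩ := List.get_of_mem hf
      rw [coord_totalExpo_var hl, he _ hf]
    · rw [coord_totalExpo_of_notMem _ hv, he' v hv]
  rw [nordSeries, finsum_eq_single _ fun k => N (l.get k).var, if_pos hN, Factor.totalCoeff]
  · congr 1
    · rw [← List.prod_ofFn]
      congr 1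
      exact List.ofFn_getElem_eq_map l
        (fun f => ((Ring.choose (-(N f.var : ℚ) - 1 / 2) f.order : ℚ) : ℂ))
    · congr 1
      exact List.ofFn_getElem_eq_map l fun f => (f.vec, N f.var)
  · intro n hn
    refine if_neg fun h => hn (funext fun k => ?_)
    have h1 := coord_totalExpo_var hl n k
    rw [h, he _ (List.get_mem l k)] at h1
    have h2 : ((n k : ℤ) : ℚ) = (N (l.get k).var : ℤ) := by linear_combination h1
    exact Int.cast_injective h2

variable (a : Fin r → H) (b : Fin s → H) (m : Fin r → ℕ) (n : Fin s → ℕ)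
  (I : Finset (Fin r)) (J : Finset (Fin s))

theorem isSeriesIn_nordSeries :
    IsSeriesIn (varSet I J)ᶜ (nordSeries B U (xFactors s a m I ++ yFactors r b n J)) := by
  intro e he v hv
  obtain ⟨k, rfl⟩ := exists_totalExpo_of_nordSeries_ne_zero B U he
  exact coord_totalExpo_of_notMem k fun h => hv ((mem_map_var_factors a b m n I J v).1 h)

/-- The coordinate of a monomial at `v` is the exponent of `(v ^ (-k - 1/2))^{(m)}` for an integer
`k`, where `m` is the order attached to `v`. -/
def IsModeExpo (e : Expo r s) (v : Fin r ⊕ Fin s) (k : ℤ) : Prop :=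
  coord e v = -(k : ℚ) - 1 / 2 - ((Sum.elim m n v : ℕ) : ℚ)

theorem exists_isModeExpo_of_nordSeries_ne_zero {e : Expo r s}
    (he : nordSeries B U (xFactors s a m I ++ yFactors r b n J) e ≠ 0) (v : Fin r ⊕ Fin s)
    (hv : v ∉ varSet I J) : ∃ k, IsModeExpo m n e v k := by
  obtain ⟨N, rfl⟩ := exists_totalExpo_of_nordSeries_ne_zero B U he
  have hmem := (mem_map_var_factors a b m n I J v).2 hv
  obtain ⟨f, hf, rfl⟩ := List.mem_map.1 hmem
  have horder : f.order = Sum.elim m n f.var := by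
    rcases List.mem_append.1 hf with hf | hf
    · obtain ⟨i, _, rfl⟩ := List.mem_map.1 hf
      rfl
    · obtain ⟨j, _, rfl⟩ := List.mem_map.1 hf
      rfl
  obtain ⟨k, rfl⟩ := List.get_of_mem hf
  refine ⟨N k, ?_⟩
  rw [IsModeExpo, coord_totalExpo_var (nodup_map_var_factors a b m n I J), horder]

/-- The coefficient of `(v ^ (-k - 1/2))^{(m)}`. -/
def modeCoeff (N : Fin r ⊕ Fin s → ℤ) (v : Fin r ⊕ Fin s) : ℂ :=
  ((Ring.choose (-(N v : ℚ) - 1 / 2) (Sum.elim m n v) : ℚ) : ℂ)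

theorem nordSeries_factors_eq {e : Expo r s} {N : Fin r ⊕ Fin s → ℤ}
    (he : ∀ v, IsModeExpo m n e v (N v)) :
    nordSeries B U (xFactors s a m I ++ yFactors r b n J) (restrict (varSet I J)ᶜ e) =
      ((∏ i ∈ Iᶜ, modeCoeff m n N (Sum.inl i)) * ∏ j ∈ Jᶜ, modeCoeff m n N (Sum.inr j)) •
        nord B U (omitList (fun i => (a i, N (Sum.inl i))) I ++
          omitList (fun j => (b j, N (Sum.inr j))) J) := by
  classical
  rw [nordSeries_eq_smul_nord B U (nodup_map_var_factors a b m n I J) N]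
  · have hprod : ∀ {t : ℕ} (K : Finset (Fin t)) (f : Fin t → ℂ),
        (((List.finRange t).filter fun i => i ∉ K).map f).prod = ∏ i ∈ Kᶜ, f i := by
      intro t K f
      rw [← List.prod_toFinset f ((List.nodup_finRange t).filter _)]
      congr 1
      ext x
      simp
    rw [List.map_append, List.map_append, List.prod_append, xFactors, yFactors, List.map_map,
      List.map_map, List.map_map, List.map_map, ← hprod, ← hprod, omitList, omitList]
    -- What remains is a difference between decidability instances in the filters.
    congr!
  · intro f hf
    have hmem : f.var ∉ varSet I J :=
      (mem_map_var_factors a b m n I J f.var).1 (List.mem_map_of_mem hf)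
    rw [coord_restrict_of_mem _ (Set.mem_compl hmem), he f.var]
    rcases List.mem_append.1 hf with hf | hf
    · obtain ⟨i, _, rfl⟩ := List.mem_map.1 hf
      rfl
    · obtain ⟨j, _, rfl⟩ := List.mem_map.1 hf
      rfl
  · intro v hv
    exact coord_restrict_of_notMem _ fun h => hv ((mem_map_var_factors a b m n I J v).2 h)

end NordSeries

/-! ### Coefficients of the determinants -/

section Determinant

variable {H : Type*} [AddCommGroup H] [Module ℂ H] (B : LinearMap.BilinForm ℂ H) {r s : ℕ}
  (a : Fin r → H) (b : Fin s → H) (m : Fin r → ℕ) (n : Fin s → ℕ) {ρ : ℕ}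
  {i : Fin ρ → Fin r} {j : Fin ρ → Fin s}

/-- In each Leibniz term the factors are series in disjoint pairs of variables, so its coefficient
is a product of coefficients; summing over the permutations gives a determinant again. -/
theorem coeff_contractionDet (hi : Function.Injective i) (hj : Function.Injective j) :
    IsSeriesIn (varSet (Finset.univ.image i) (Finset.univ.image j))
        (contractionDet B a b m n i j).coeff ∧
      ∀ e, (contractionDet B a b m n i j).coeff
          (restrict (varSet (Finset.univ.image i) (Finset.univ.image j)) e) =
        Matrix.det (Matrix.of fun k l => B (a (i k)) (b (j l)) *
          (G (m (i k)) (n (j l)) (i k) (j l)).coeff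
            (pairExpo (i k) (j l) (coord e (Sum.inl (i k))) (coord e (Sum.inr (j l))))) := by
  set V := varSet (Finset.univ.image i) (Finset.univ.image j) with hVdef
  have hexp : ∀ e, (contractionDet B a b m n i j).coeff e =
      ∑ σ : Equiv.Perm (Fin ρ), ((Equiv.Perm.sign σ : ℤ) : ℂ) *
        (∏ k, B (a (i (σ k))) (b (j k)) • G (m (i (σ k))) (n (j k)) (i (σ k)) (j k) :
          HahnSeries (Expo r s) ℂ).coeff e := by
    intro e
    rw [contractionDet, Matrix.det_apply, HahnSeries.coeff_sum]
    refine Finset.sum_congr rfl fun σ _ => ?_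
    rcases Int.units_eq_one_or (Equiv.Perm.sign σ) with h | h <;> rw [h] <;> simp
  have hprod : ∀ σ : Equiv.Perm (Fin ρ), _ := fun σ =>
    coeff_prod_of_isSeriesIn Finset.univ
      (fun k => ({Sum.inl (i (σ k)), Sum.inr (j k)} : Set (Fin r ⊕ Fin s)))
      (fun k => B (a (i (σ k))) (b (j k)) • G (m (i (σ k))) (n (j k)) (i (σ k)) (j k))
      (fun k _ e he => isSeriesIn_iota (i (σ k)) (j k) _ e fun h0 => he (by
        rw [HahnSeries.coeff_smul, G, h0, smul_zero]))
      (fun k _ l _ hkl => by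
        have h1 : i (σ k) ≠ i (σ l) := fun h => hkl (σ.injective (hi h))
        have h2 : j k ≠ j l := fun h => hkl (hj h)
        simp [Function.onFun, h1.symm, h2.symm])
  -- For every permutation the pairs of variables cover the same set `V`, so the same restriction of
  -- `e` is used in all Leibniz terms.
  have hsub : ∀ σ : Equiv.Perm (Fin ρ), ∀ k,
      ({Sum.inl (i (σ k)), Sum.inr (j k)} : Set (Fin r ⊕ Fin s)) ⊆ V := by
    rintro σ k v (rfl | rfl) <;> simp [hVdef, varSet]
  have hsup : ∀ σ : Equiv.Perm (Fin ρ), V ⊆ ⋃ k ∈ (Finset.univ : Finset (Fin ρ)),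
      ({Sum.inl (i (σ k)), Sum.inr (j k)} : Set (Fin r ⊕ Fin s)) := by
    rintro σ (v | v) hv
    · obtain ⟨k, _, rfl⟩ := Finset.mem_image.1 (show v ∈ Finset.univ.image i from hv)
      exact Set.mem_iUnion₂.2 ⟨σ.symm k, Finset.mem_univ _, by simp⟩
    · obtain ⟨k, _, rfl⟩ := Finset.mem_image.1 (show v ∈ Finset.univ.image j from hv)
      exact Set.mem_iUnion₂.2 ⟨k, Finset.mem_univ _, by simp⟩
  constructor
  · intro e he v hv
    rw [hexp] at he
    obtain ⟨σ, _, hne⟩ := Finset.exists_ne_zero_of_sum_ne_zero he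
    refine (hprod σ).1 e (right_ne_zero_of_mul hne) v fun h => hv ?_
    obtain ⟨k, _, hk⟩ := Set.mem_iUnion₂.1 h
    exact hsub σ k hk
  · intro e
    rw [hexp, Matrix.det_apply']
    refine Finset.sum_congr rfl fun σ _ => ?_
    congr 1
    rw [(hprod σ).2 _ fun v hv => coord_restrict_of_notMem _ fun h => hv (hsup σ h)]
    refine Finset.prod_congr rfl fun k _ => ?_
    rw [restrict_restrict (hsub σ k), restrict_pair, HahnSeries.coeff_smul, smul_eq_mul,
      Matrix.of_apply]

theorem coeff_contractionDet_eq (hi : Function.Injective i) (hj : Function.Injective j)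
    {e : Expo r s} {N : Fin r ⊕ Fin s → ℤ} (he : ∀ v, IsModeExpo m n e v (N v)) :
    (contractionDet B a b m n i j).coeff
        (restrict (varSet (Finset.univ.image i) (Finset.univ.image j)) e) =
      (∏ k ∈ Finset.univ.image i, modeCoeff m n N (Sum.inl k)) *
        (∏ k ∈ Finset.univ.image j, modeCoeff m n N (Sum.inr k)) *
          Matrix.det (Matrix.of fun k l =>
            modePairing B (a (i k), N (Sum.inl (i k))) (b (j l), N (Sum.inr (j l)))) := by
  rw [(coeff_contractionDet B a b m n hi hj).2 e, Finset.prod_image fun _ _ _ _ h => hi h,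
    Finset.prod_image fun _ _ _ _ h => hj h, mul_assoc, ← Matrix.det_mul_row,
    ← Matrix.det_mul_column]
  congr 1
  ext k l
  simp only [Matrix.of_apply]
  rw [coeff_G_of_int (i k) (j l) (m (i k)) (n (j l)) (N (Sum.inl (i k))) (N (Sum.inr (j l))) (he (Sum.inl (i k)))
    (he (Sum.inr (j l))), modePairing, modeCoeff, modeCoeff]
  simp only [Sum.elim_inl, Sum.elim_inr]
  ring

/-- An inadmissible exponent of some `x` makes a row of the coefficient matrix vanish, and one of
some `y` makes a column vanish. -/
theorem exists_isModeExpo_of_coeff_contractionDet_ne_zero (hi : Function.Injective i)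
    (hj : Function.Injective j) {e : Expo r s}
    (he : (contractionDet B a b m n i j).coeff
      (restrict (varSet (Finset.univ.image i) (Finset.univ.image j)) e) ≠ 0)
    (v : Fin r ⊕ Fin s) (hv : v ∈ varSet (Finset.univ.image i) (Finset.univ.image j)) :
    ∃ k, IsModeExpo m n e v k := by
  rw [(coeff_contractionDet B a b m n hi hj).2 e] at he
  by_contra hne
  rcases v with v | v
  · obtain ⟨k, _, rfl⟩ := Finset.mem_image.1 (show v ∈ Finset.univ.image i from hv)
    refine he (Matrix.det_eq_zero_of_row_eq_zero k fun l => ?_)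
    rw [Matrix.of_apply]
    by_contra h
    exact hne (exists_int_of_coeff_G_ne_zero _ _ (right_ne_zero_of_mul h)).1
  · obtain ⟨l, _, rfl⟩ := Finset.mem_image.1 (show v ∈ Finset.univ.image j from hv)
    refine he (Matrix.det_eq_zero_of_column_eq_zero l fun k => ?_)
    rw [Matrix.of_apply]
    by_contra h
    exact hne (exists_int_of_coeff_G_ne_zero _ _ (right_ne_zero_of_mul h)).2

end Determinant

/-! ### Wick's theorem -/

section Wick

variable {H : Type*} [AddCommGroup H] [Module ℂ H] (B : LinearMap.BilinForm ℂ H)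
  (U : Type*) [AddCommGroup U] [Module ℂ U] [Module (TensorAlgebra ℂ H) U] {r s : ℕ}

open Classical in
theorem nord_mul_nord_eq_sum (A : Fin r → H × ℤ) (L : Fin s → H × ℤ) :
    nord B U (List.ofFn A) * nord B U (List.ofFn L) =
      nord B U (List.ofFn A ++ List.ofFn L) + ∑ ρ ∈ Finset.Icc 1 (min r s),
        ∑ i : Fin ρ → Fin r with StrictMono i, ∑ j : Fin ρ → Fin s with StrictMono j,
          detTerm (modePairing B) A L (nord B U) i j := by
  have hmono : ∀ {r : ℕ} (i : Fin 0 → Fin r), StrictMono i := fun i k => k.elim0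
  rw [nord_mul_nord, wickSum_eq_sum_detTerm, Finset.sum_range_succ', add_comm]
  congr 1
  · simp [hmono, detTerm, contractionSign, omitList_empty]
  · rw [Finset.sum_image (s := Finset.range r) (g := fun ρ => ρ + 1) (f := fun ρ =>
      ∑ i : Fin ρ → Fin r with StrictMono i, ∑ j : Fin ρ → Fin s with StrictMono j,
          detTerm (modePairing B) A L (nord B U) i j) (by intro x _ y _ h; simpa using h) |>.symm]
    symm
    refine Finset.sum_subset ?_ ?_
    · intro ρ hρ
      rw [Finset.mem_Icc] at hρ
      exact Finset.mem_image.2 ⟨ρ - 1, Finset.mem_range.2 (by omega), by omega⟩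
    · intro ρ hρ hρ'
      obtain ⟨ρ', hr, rfl⟩ := Finset.mem_image.1 hρ
      rw [Finset.mem_range] at hr
      rw [Finset.mem_Icc] at hρ'
      -- Here `ρ' + 1 ≤ r` lies outside the range up to `min r s`, so it exceeds `s`.
      exact Finset.sum_eq_zero fun i _ => sum_strictMono_of_lt (by omega) _

variable (a : Fin r → H) (b : Fin s → H) (m : Fin r → ℕ) (n : Fin s → ℕ)

theorem varSet_univ_empty : varSet (Finset.univ : Finset (Fin r)) (∅ : Finset (Fin s)) =
    (varSet ∅ Finset.univ)ᶜ := by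
  ext v
  rcases v with v | v <;> simp [varSet]

theorem isSeriesIn_xFactors :
    IsSeriesIn (varSet Finset.univ ∅) (nordSeries B U (xFactors s a m ∅)) := by
  -- The product of the `x`-factors alone is a mixed product with all `y`-factors omitted, so the
  -- data chosen for the latter are immaterial.
  have h := isSeriesIn_nordSeries B U a (fun _ : Fin s => (0 : H)) m (fun _ => 0) ∅ Finset.univ
  rwa [yFactors_univ, List.append_nil, ← varSet_univ_empty] at h

theorem isSeriesIn_yFactors :
    IsSeriesIn (varSet Finset.univ ∅)ᶜ (nordSeries B U (yFactors r b n ∅)) := by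
  have h := isSeriesIn_nordSeries B U (fun _ : Fin r => (0 : H)) b (fun _ => 0) n Finset.univ ∅
  rwa [xFactors_univ, List.nil_append] at h

theorem conv_nordSeries_eq (e : Expo r s) :
    conv (nordSeries B U (xFactors s a m ∅)) (nordSeries B U (yFactors r b n ∅)) e =
      nordSeries B U (xFactors s a m ∅ ++ yFactors r b n Finset.univ)
          (restrict (varSet ∅ Finset.univ)ᶜ e) *
        nordSeries B U (xFactors s a m Finset.univ ++ yFactors r b n ∅)
          (restrict (varSet Finset.univ ∅)ᶜ e) := by
  rw [conv_eq_of_isSeriesIn (isSeriesIn_xFactors B U a m) (isSeriesIn_yFactors B U b n),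
    xFactors_univ, yFactors_univ, List.append_nil, List.nil_append, varSet_univ_empty, smul_eq_mul]

-- At a monomial whose exponents all belong to modes, both sides are the same product of binomial
-- coefficients times the two sides of `nord_mul_nord_eq_sum`. At all other monomials every term
-- vanishes.
open Classical in
theorem wick :
    conv (nordSeries B U (xFactors s a m ∅)) (nordSeries B U (yFactors r b n ∅)) =
      nordSeries B U (xFactors s a m ∅ ++ yFactors r b n ∅) +
        ∑ ρ ∈ Finset.Icc 1 (min r s),
          ∑ i : Fin ρ → Fin r with StrictMono i, ∑ j : Fin ρ → Fin s with StrictMono j,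
            contractionSign r i j • conv (contractionDet B a b m n i j).coeff
              (nordSeries B U (xFactors s a m (Finset.univ.image i) ++
                yFactors r b n (Finset.univ.image j))) := by
  funext e
  have hempty : restrict (varSet (∅ : Finset (Fin r)) (∅ : Finset (Fin s)))ᶜ e = e :=
    coord_ext fun v => coord_restrict_of_mem _ (by rcases v with v | v <;> simp [varSet])
  have hterm : ∀ (ρ : ℕ) (i : Fin ρ → Fin r) (j : Fin ρ → Fin s), StrictMono i → StrictMono j →
      conv (contractionDet B a b m n i j).coeff
        (nordSeries B U (xFactors s a m (Finset.univ.image i) ++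
          yFactors r b n (Finset.univ.image j))) e = _ := fun ρ i j hi hj =>
    conv_eq_of_isSeriesIn (coeff_contractionDet B a b m n hi.injective hj.injective).1
      (isSeriesIn_nordSeries B U a b m n _ _) e
  rw [conv_nordSeries_eq, Pi.add_apply]
  simp only [Finset.sum_apply, Pi.smul_apply]
  by_cases hint : ∀ v, ∃ k, IsModeExpo m n e v k
  · choose N hN using hint
    set A : Fin r → H × ℤ := fun i => (a i, N (Sum.inl i)) with hA
    set L : Fin s → H × ℤ := fun j => (b j, N (Sum.inr j)) with hL
    set z : ℂ := (∏ i, modeCoeff m n N (Sum.inl i)) * ∏ j, modeCoeff m n N (Sum.inr j) with hz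
    have hfirst : nordSeries B U (xFactors s a m ∅ ++ yFactors r b n ∅) e =
        z • nord B U (List.ofFn A ++ List.ofFn L) := by
      have h := nordSeries_factors_eq B U a b m n ∅ ∅ hN
      rwa [hempty, Finset.compl_empty, Finset.compl_empty, omitList_empty, omitList_empty] at h
    have hnil : ∀ {X : Type _} {t : ℕ} (f : Fin t → X), omitList f Finset.univ = [] := by
      intro X t f
      simp [omitList]
    rw [hfirst, nordSeries_factors_eq B U a b m n ∅ Finset.univ hN,
      nordSeries_factors_eq B U a b m n Finset.univ ∅ hN, hnil, hnil, omitList_empty,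
      omitList_empty, Finset.compl_empty, Finset.compl_empty, Finset.compl_univ,
      Finset.compl_univ, Finset.prod_empty, Finset.prod_empty, mul_one, one_mul, List.append_nil,
      List.nil_append, smul_mul_smul_comm, nord_mul_nord_eq_sum, smul_add]
    congr 1
    simp only [Finset.smul_sum]
    refine Finset.sum_congr rfl fun ρ _ => Finset.sum_congr rfl fun i hi =>
      Finset.sum_congr rfl fun j hj => ?_
    have hi' := (Finset.mem_filter.1 hi).2
    have hj' := (Finset.mem_filter.1 hj).2
    rw [hterm ρ i j hi' hj', nordSeries_factors_eq B U a b m n _ _ hN,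
      coeff_contractionDet_eq B a b m n hi'.injective hj'.injective hN, detTerm, smul_smul,
      smul_smul, smul_smul]
    congr 1
    -- The binomial coefficients of the contracted variables come from the determinant, and those of
    -- the remaining variables from the normal-ordered product.
    rw [← Finset.prod_mul_prod_compl (Finset.univ.image i) fun i => modeCoeff m n N (Sum.inl i),
      ← Finset.prod_mul_prod_compl (Finset.univ.image j) fun j => modeCoeff m n N (Sum.inr j)]
    ring
  -- Some variable has an exponent that belongs to no mode. If it is not among the contracted
  -- variables, the normal-ordered product of the remaining factors has coefficient zero.
  · have hzero : ∀ (I : Finset (Fin r)) (J : Finset (Fin s)), (∀ v ∈ varSet I J,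
        ∃ k, IsModeExpo m n e v k) → nordSeries B U (xFactors s a m I ++ yFactors r b n J)
          (restrict (varSet I J)ᶜ e) = 0 := by
      intro I J hIJ
      by_contra hne
      refine hint fun v => ?_
      by_cases hv : v ∈ varSet I J
      · exact hIJ v hv
      · obtain ⟨k, hk⟩ := exists_isModeExpo_of_nordSeries_ne_zero B U a b m n I J hne v hv
        rw [IsModeExpo, coord_restrict_of_mem _ (Set.mem_compl hv)] at hk
        exact ⟨k, hk⟩
    have h0 : nordSeries B U (xFactors s a m ∅ ++ yFactors r b n ∅) e = 0 := by
      have := hzero ∅ ∅ fun v hv => by rcases v with v | v <;> simp [varSet] at hv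
      rwa [hempty] at this
    rw [h0, zero_add]
    trans 0
    · by_contra hne
      refine left_ne_zero_of_mul hne (hzero ∅ Finset.univ fun v hv => ?_)
      have hv' : v ∉ varSet (Finset.univ : Finset (Fin r)) (∅ : Finset (Fin s)) := by
        rw [varSet_univ_empty]
        exact Set.notMem_compl_iff.2 hv
      obtain ⟨k, hk⟩ := exists_isModeExpo_of_nordSeries_ne_zero B U a b m n _ _
        (right_ne_zero_of_mul hne) v hv'
      rw [IsModeExpo, coord_restrict_of_mem _ (Set.mem_compl hv')] at hk
      exact ⟨k, hk⟩
    · symm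
      refine Finset.sum_eq_zero fun ρ _ => Finset.sum_eq_zero fun i hi =>
        Finset.sum_eq_zero fun j hj => ?_
      have hi' := (Finset.mem_filter.1 hi).2
      have hj' := (Finset.mem_filter.1 hj).2
      rw [hterm ρ i j hi' hj']
      -- A nonzero determinant coefficient forces the exponents of the contracted variables to be
      -- admissible, so the bad exponent belongs to a remaining factor.
      by_cases hd : (contractionDet B a b m n i j).coeff
          (restrict (varSet (Finset.univ.image i) (Finset.univ.image j)) e) = 0
      · rw [hd, zero_smul, smul_zero]
      · rw [hzero _ _ (exists_isModeExpo_of_coeff_contractionDet_ne_zero B a b m n hi'.injective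
          hj'.injective hd), smul_zero, smul_zero]

end Wick

end TwistedFock

end

open Classical in
theorem mainTheorem2 {H U : Type*} [AddCommGroup H] [Module ℂ H] [FiniteDimensional ℂ H]
    (B : LinearMap.BilinForm ℂ H) (hsymm : B.IsSymm) (hnondeg : B.Nondegenerate)
    (M : ℕ) (P Q : Submodule ℂ H) (hPQ : IsCompl P Q)
    (hP : ∀ x ∈ P, ∀ y ∈ P, B x y = 0) (hQ : ∀ x ∈ Q, ∀ y ∈ Q, B x y = 0)
    (hPdim : Module.finrank ℂ P = M) (hQdim : Module.finrank ℂ Q = M)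
    [AddCommGroup U] [Module ℂ U] [Module (TensorAlgebra ℂ H) U]
    [IsScalarTower ℂ (TensorAlgebra ℂ H) U]
    (r s : ℕ) (hr : 0 < r) (hs : 0 < s)
    (a : Fin r → H) (b : Fin s → H) (m : Fin r → ℕ) (n : Fin s → ℕ) :
    TwistedFock.ConvExists
        (TwistedFock.nordSeries B U (TwistedFock.xFactors s a m ∅))
        (TwistedFock.nordSeries B U (TwistedFock.yFactors r b n ∅)) ∧
    (∀ (ρ : ℕ) (i : Fin ρ → Fin r) (j : Fin ρ → Fin s), StrictMono i → StrictMono j →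
      TwistedFock.ConvExists
        (TwistedFock.contractionDet B a b m n i j).coeff
        (TwistedFock.nordSeries B U
          (TwistedFock.xFactors s a m (Finset.univ.image i) ++
            TwistedFock.yFactors r b n (Finset.univ.image j)))) ∧
    TwistedFock.conv
        (TwistedFock.nordSeries B U (TwistedFock.xFactors s a m ∅))
        (TwistedFock.nordSeries B U (TwistedFock.yFactors r b n ∅)) =
      TwistedFock.nordSeries B U
          (TwistedFock.xFactors s a m ∅ ++ TwistedFock.yFactors r b n ∅) +
        ∑ ρ ∈ Finset.Icc 1 (min r s),
          ∑ i : Fin ρ → Fin r with StrictMono i, ∑ j : Fin ρ → Fin s with StrictMono j,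
            ((-1 : ℂ) ^ (∑ k, ((i k : ℕ) + 1) + ∑ k, ((j k : ℕ) + 1)) *
                (-1) ^ (r * ρ + ρ * (ρ + 1) / 2)) •
              TwistedFock.conv
                (TwistedFock.contractionDet B a b m n i j).coeff
                (TwistedFock.nordSeries B U
                  (TwistedFock.xFactors s a m (Finset.univ.image i) ++
                    TwistedFock.yFactors r b n (Finset.univ.image j))) := by
  have hconv : ∀ (ρ : ℕ) (i : Fin ρ → Fin r) (j : Fin ρ → Fin s), StrictMono i → StrictMono j →
      TwistedFock.ConvExists (TwistedFock.contractionDet B a b m n i j).coeff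
        (TwistedFock.nordSeries B U
          (TwistedFock.xFactors s a m (Finset.univ.image i) ++
            TwistedFock.yFactors r b n (Finset.univ.image j))) := fun ρ i j hi hj =>
    TwistedFock.convExists_of_isSeriesIn
      (TwistedFock.coeff_contractionDet B a b m n hi.injective hj.injective).1
      (TwistedFock.isSeriesIn_nordSeries B U a b m n _ _)
  -- The sign in the statement is `contractionSign` unfolded, so `wick` applies definitionally.
  exact ⟨TwistedFock.convExists_of_isSeriesIn (TwistedFock.isSeriesIn_xFactors B U a m)
    (TwistedFock.isSeriesIn_yFactors B U b n), hconv, TwistedFock.wick B U a b m n⟩
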